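/- Let $\mathcal G=(\mathbb V,\mathcal E)$ be a simple undirected, connected, locally finite graph with positive symmetric conductances $(a_{x,y})_{(x,y)\in\mathcal E}$, and put $a_x=\sum_{z\sim x}a_{x,z}$. Let $P_x$ be the law of the Markov chain $X$ started at $x$ with transition probabilities $p_{x,y}=a_{x,y}/a_x$ for $x\sim y$ (and $0$ otherwise), and assume that $X$ is transient. For $K\subset\mathbb V$ let $\tau_K=\inf\{n\ge 0:X_n\in K\}$ and $\tau_K^+=\inf\{n\ge 1:X_n\in K\}$, and for finite $K$ let $e_K(x)=a_xP_x[\tau_K^+=\infty]$ for $x\in K$, $e_K(x)=0$ otherwise (the equilibrium measure). Let $W^+$ and $W$ be the sets of nearest-neighbour trajectories indexed by $\{0,1,2,\dots\}$ and by $\mathbb Z$, respectively, that visit each vertex finitely often, with the $\sigma$-algebras generated by the coordinates; let $W^*$ be the quotient of $W$ by time shifts, with projection $\pi^*$ and the quotient $\sigma$-algebra, and let $W_K$, $W_K^*=\pi^*(W_K)$ be the trajectories that visit $K$. For finite $K$ let $\nu_K$ be the measure on $W$ with $$\nu_K\big((w_{-n})_{n\ge0}\in A,\ w_0=x,\ (w_n)_{n\ge0}\in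 B\big)=P_x[A\mid\tau_K^+=\infty]\,e_K(x)\,P_x[B],$$ and let $\nu=\big(\sum_{n\ge1}\nu_{K_n}\mathbf 1_{W_{K_n}\setminus W_{K_{n-1}}}\big)\circ(\pi^*)^{-1}$, where $(K_n)_{n\ge 0}$ is any exhaustion of $\mathbb V$ (an increasing sequence of finite sets with union $\mathbb V$) with $K_0=\emptyset$. Let $\Omega$ be the set of at most countable sums $\omega=\sum_i\delta_{w_i^*}$ of Dirac masses on $W^*$ such that $\omega(W_K^*)<\infty$ for all finite $K$, with the $\sigma$-algebra generated by the maps $\omega\mapsto\omega(D)$, $D\subset W^*$ measurable, and let $\mathbb P$ be the law on $\Omega$ of a Poisson point process with intensity $\nu$. For finite $K$ and $w\in W_K$, let $\tau_K(w)$ and $\lambda_K(w)$ be the first and last times at which $w$ is in $K$, and put $Out_{K\to}(w)=(w_{\lambda_K(w)+n})_{n\ge0}$ and $Out_{\to K}(w)=(w_{\tau_K(w)+n})_{n\le0}$. For $\omega=\sum_i\delta_{w_i^*}$, with representatives $w_i$ of $w_i^*$, put $$\mathrm{Out}_{K\to}(\omega)=\sum_{i:\,w_i^*\in W_K^*}\delta_{Out_{K\to}(w_i)}+\sum_{i:\,w_i^*\notin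 W_K^*}\delta_{w_i^*},\qquad \mathcal T_{RI\to}=\bigcap_{K\text{ finite}}\sigma(\mathrm{Out}_{K\to}),$$ and define $\mathrm{Out}_{\to K}$ and $\mathcal T_{\to RI}=\bigcap_{K\text{ finite}}\sigma(\mathrm{Out}_{\to K})$ in the same way with $Out_{\to K}$ in place of $Out_{K\to}$. **Theorem.** 1. Every event in $\mathcal T_{RI\to}$ has probability $0$ or $1$ under $\mathbb P$. 2. Every event in $\mathcal T_{\to RI}$ has probability $0$ or $1$ under $\mathbb P$. 3. For every $x\in\mathbb V$, every $\epsilon>0$ and every exhaustion $(L_n)_{n\ge0}$ of $\mathbb V$, $$e_{L_n}\big(\{x'\in\mathbb V:P_{x'}[\tau_x<\infty]>\epsilon\}\big)\longrightarrow0\quad\text{as }n\to\infty.$$ -/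

import Mathlib

open MeasureTheory ProbabilityTheory Filter Topology
open scoped ENNReal

noncomputable section

namespace Interlacement

variable {V : Type*}

/-- A weighted graph: a simple undirected, connected, locally finite graph with positive symmetric
conductances on its edges (the values of `cond` off the edges are never used). -/
structure Network (V : Type*) where
  graph : SimpleGraph V
  connected : graph.Connected
  locallyFinite : ∀ x, (graph.neighborSet x).Finite
  cond : V → V → ℝ
  cond_symm : ∀ x y, graph.Adj x y → cond x y = cond y x
  cond_pos : ∀ x y, graph.Adj x y → 0 < cond x y

/-- An exhaustion: an increasing sequence of finite vertex sets whose union is everything. -/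
structure IsExhaustion (L : ℕ → Finset V) : Prop where
  mono : Monotone L
  cover : ∀ x, ∃ n, x ∈ L n

/-- Hitting time `inf {n ≥ 0 : w n ∈ K}` of a one-sided path, `⊤` if there is no such `n`. -/
def hitTime (K : Set V) (w : ℕ → V) : ℕ∞ := ⨅ (n : ℕ) (_ : w n ∈ K), (n : ℕ∞)

/-- Return time `inf {n ≥ 1 : w n ∈ K}` of a one-sided path, `⊤` if there is no such `n`. -/
def returnTime (K : Set V) (w : ℕ → V) : ℕ∞ := ⨅ (n : ℕ) (_ : 1 ≤ n ∧ w n ∈ K), (n : ℕ∞)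

theorem hitTime_eq_top_iff {K : Set V} {w : ℕ → V} :
    hitTime K w = ⊤ ↔ ∀ n, w n ∉ K := by
  simp [hitTime, iInf_eq_top]

theorem returnTime_eq_top_iff {K : Set V} {w : ℕ → V} :
    returnTime K w = ⊤ ↔ ∀ n, 1 ≤ n → w n ∉ K := by
  simp [returnTime, iInf_eq_top]

namespace Network

variable (N : Network V)

/-- `a_x = ∑_{z ∼ x} a_{x,z}`. -/
def total (x : V) : ℝ := ∑ z ∈ (N.locallyFinite x).toFinset, N.cond x z

/-- The transition probabilities `p_{x,y} = a_{x,y} / a_x` for `y ∼ x`, and `0` otherwise. -/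
def p (x y : V) : ℝ :=
  open Classical in if N.graph.Adj x y then N.cond x y / N.total x else 0

variable [MeasurableSpace V]

/-- The one-step law from `x`. The first case occurs only in the one-vertex graph; the chain is
then put to rest (and it is not transient). -/
def step (x : V) : Measure V :=
  open Classical in
  if N.total x = 0 then Measure.dirac x
  else ∑ y ∈ (N.locallyFinite x).toFinset, ENNReal.ofReal (N.p x y) • Measure.dirac y

instance (x : V) : IsProbabilityMeasure (N.step x) := by
  constructor
  unfold step
  split_ifs with h
  · simp
  · simp only [Measure.coe_finsetSum, Finset.sum_apply, Measure.smul_apply, measure_univ,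
      smul_eq_mul, mul_one]
    have hpos : ∀ z ∈ (N.locallyFinite x).toFinset, 0 < N.cond x z := by
      intro z hz
      exact N.cond_pos x z (by simpa using hz)
    have hp : ∀ z ∈ (N.locallyFinite x).toFinset, N.p x z = N.cond x z / N.total x := by
      intro z hz
      have : N.graph.Adj x z := by simpa using hz
      simp [p, this]
    have ht : 0 ≤ N.total x := Finset.sum_nonneg fun z hz => (hpos z hz).le
    rw [← ENNReal.ofReal_sum_of_nonneg, Finset.sum_congr rfl hp, ← Finset.sum_div]
    · rw [← total, div_self h, ENNReal.ofReal_one]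
    · intro z hz
      rw [hp z hz]
      exact div_nonneg (hpos z hz).le ht

variable [DiscreteMeasurableSpace V]

/-- The transition kernel of the chain. -/
def stepKernel : Kernel V V where
  toFun := N.step
  measurable' := Measurable.of_discrete

instance : IsMarkovKernel N.stepKernel := ⟨fun x => by
  change IsProbabilityMeasure (N.step x); infer_instance⟩

/-- The law `P_x` of the Markov chain started from `x`, on the space of all sequences. -/
def P (x : V) : Measure (ℕ → V) :=
  Kernel.traj (X := fun _ : ℕ => V)
    (fun n => N.stepKernel.comap (fun h : (i : Finset.Iic n) → V => h ⟨n, by simp⟩)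
      (measurable_pi_apply _)) 0 (fun _ => x)

instance (x : V) : IsProbabilityMeasure (N.P x) := by
  unfold P; infer_instance

/-- The chain is transient: from every vertex, it has a positive probability of never returning. -/
def IsTransient : Prop := ∀ x, 0 < N.P x {w | returnTime {x} w = ⊤}

/-- The mass `e_K(x) = a_x P_x[τ_K⁺ = ∞]` for `x ∈ K`, and `0` for `x ∉ K`. -/
def eqMass (K : Finset V) (x : V) : ℝ≥0∞ :=
  open Classical in
  if x ∈ K then ENNReal.ofReal (N.total x) * N.P x {w | returnTime (K : Set V) w = ⊤} else 0

/-- The equilibrium measure `e_K` on the vertex set. -/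
def eqMeasure (K : Finset V) : Measure V := ∑ x ∈ K, N.eqMass K x • Measure.dirac x

end Network

section Trajectories

variable (G : SimpleGraph V)

/-- `W⁺`: transient nearest-neighbour trajectories indexed by the nonnegative integers. -/
def HalfTraj : Type _ :=
  {w : ℕ → V // (∀ n, G.Adj (w n) (w (n + 1))) ∧ ∀ x, {n | w n = x}.Finite}

/-- `W`: transient nearest-neighbour trajectories indexed by the integers. -/
def Traj : Type _ :=
  {w : ℤ → V // (∀ n, G.Adj (w n) (w (n + 1))) ∧ ∀ x, {n | w n = x}.Finite}

instance [MeasurableSpace V] : MeasurableSpace (HalfTraj G) := Subtype.instMeasurableSpace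

instance [MeasurableSpace V] : MeasurableSpace (Traj G) := Subtype.instMeasurableSpace

variable {G}

/-- The trajectory `w` visits `K`. -/
def Traj.Hits (K : Finset V) (w : Traj G) : Prop := ∃ n, w.1 n ∈ K

/-- First visit time to `K` (meaningful for trajectories visiting `K`). -/
def Traj.tau (K : Finset V) (w : Traj G) : ℤ := sInf {n | w.1 n ∈ K}

/-- Last visit time to `K` (meaningful for trajectories visiting `K`). -/
def Traj.lam (K : Finset V) (w : Traj G) : ℤ := sSup {n | w.1 n ∈ K}

/-- The future piece `(w_{λ_K + n})_{n ≥ 0}`. -/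
def Traj.future (K : Finset V) (w : Traj G) : HalfTraj G :=
  ⟨fun n => w.1 (w.lam K + n), by
    refine ⟨fun n => ?_, fun x => ?_⟩
    · have := w.2.1 (w.lam K + n)
      simpa [add_assoc] using this
    · refine Set.Finite.of_finite_image ((w.2.2 x).subset ?_)
        (f := fun n : ℕ => w.lam K + (n : ℤ)) ?_
      · rintro _ ⟨n, hn, rfl⟩
        exact hn
      · intro m _ n _ h
        simpa using h⟩

/-- The past piece `(w_{τ_K + n})_{n ≤ 0}`, read backwards in time as `n ↦ w_{τ_K - n}`, `n ≥ 0`. -/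
def Traj.past (K : Finset V) (w : Traj G) : HalfTraj G :=
  ⟨fun n => w.1 (w.tau K - n), by
    refine ⟨fun n => ?_, fun x => ?_⟩
    · have := (w.2.1 (w.tau K - (n + 1))).symm
      simpa [sub_add] using this
    · refine Set.Finite.of_finite_image ((w.2.2 x).subset ?_)
        (f := fun n : ℕ => w.tau K - (n : ℤ)) ?_
      · rintro _ ⟨n, hn, rfl⟩
        exact hn
      · intro m _ n _ h
        simpa using h⟩

variable (G) in
/-- Equality up to a time shift. -/
instance shiftSetoid : Setoid (Traj G) where
  r w w' := ∃ k : ℤ, ∀ n, w.1 (n + k) = w'.1 n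
  iseqv :=
    { refl := fun w => ⟨0, by simp⟩
      symm := by
        rintro w w' ⟨k, h⟩
        exact ⟨-k, fun n => by rw [← h, neg_add_cancel_right]⟩
      trans := by
        rintro w w' w'' ⟨k, h⟩ ⟨l, h'⟩
        exact ⟨l + k, fun n => by rw [← h', ← h, add_assoc]⟩ }

variable (G) in
/-- `W*`: transient nearest-neighbour bi-infinite trajectories up to time shift. With `V` a
measurable space it carries the quotient σ-algebra. -/
abbrev TrajMod : Type _ := Quotient (shiftSetoid G)

theorem visits_shift {K : Finset V} {w w' : Traj G} {k : ℤ} (h : ∀ n, w.1 (n + k) = w'.1 n) :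
    {n | w.1 n ∈ K} = (fun n => n + k) '' {n | w'.1 n ∈ K} := by
  ext n
  simp only [Set.mem_ofPred_eq, Set.mem_image]
  constructor
  · intro hn
    exact ⟨n - k, by rw [← h]; simpa using hn, by simp⟩
  · rintro ⟨m, hm, rfl⟩
    rw [h]; exact hm

theorem visits_finite (K : Finset V) (w : Traj G) : {n | w.1 n ∈ K}.Finite := by
  have : {n | w.1 n ∈ K} = ⋃ x ∈ K, {n | w.1 n = x} := by ext; simp
  rw [this]
  exact K.finite_toSet.biUnion fun x _ => w.2.2 x

theorem Traj.Hits.congr {K : Finset V} {w w' : Traj G} (h : w ≈ w') : w.Hits K ↔ w'.Hits K := by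
  obtain ⟨k, hk⟩ := h
  constructor
  · rintro ⟨n, hn⟩
    exact ⟨n - k, by rw [← hk]; simpa using hn⟩
  · rintro ⟨n, hn⟩
    exact ⟨n + k, by rw [hk]; exact hn⟩

theorem Traj.future_congr {K : Finset V} {w w' : Traj G} (h : w ≈ w') (hw' : w'.Hits K) :
    w.future K = w'.future K := by
  obtain ⟨k, hk⟩ := h
  have e : w.lam K = w'.lam K + k := by
    unfold lam
    rw [visits_shift hk]
    exact ((OrderIso.addRight k).map_csSup' hw' (visits_finite K w').bddAbove).symm
  apply Subtype.ext
  funext n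
  change w.1 (w.lam K + n) = w'.1 (w'.lam K + n)
  rw [e, ← hk, add_right_comm]

theorem Traj.past_congr {K : Finset V} {w w' : Traj G} (h : w ≈ w') (hw' : w'.Hits K) :
    w.past K = w'.past K := by
  obtain ⟨k, hk⟩ := h
  have e : w.tau K = w'.tau K + k := by
    unfold tau
    rw [visits_shift hk]
    exact ((OrderIso.addRight k).map_csInf' hw' (visits_finite K w').bddBelow).symm
  apply Subtype.ext
  funext n
  change w.1 (w.tau K - n) = w'.1 (w'.tau K - n)
  rw [e, ← hk, add_sub_right_comm]

variable (G) in
/-- `W_K*`: the classes of trajectories visiting `K`. -/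
def hitSet (K : Finset V) : Set (TrajMod G) := Quotient.mk _ '' {w : Traj G | w.Hits K}

/-- What remains of one trajectory when only its future after the last visit to `K` is kept:
the future piece if it visits `K`, the whole trajectory modulo shift otherwise. -/
def keepFuture (K : Finset V) : TrajMod G → HalfTraj G ⊕ TrajMod G :=
  open Classical in
  Quotient.lift (fun w : Traj G => if w.Hits K then Sum.inl (w.future K) else Sum.inr ⟦w⟧) (by
    intro w w' h
    by_cases hw : w'.Hits K
    · rw [if_pos hw, if_pos ((Traj.Hits.congr h).2 hw), Traj.future_congr h hw]
    · rw [if_neg hw, if_neg fun h' => hw ((Traj.Hits.congr h).1 h'), Quotient.sound h])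

/-- What remains of one trajectory when only its past before the first visit to `K` is kept:
the past piece if it visits `K`, the whole trajectory modulo shift otherwise. -/
def keepPast (K : Finset V) : TrajMod G → HalfTraj G ⊕ TrajMod G :=
  open Classical in
  Quotient.lift (fun w : Traj G => if w.Hits K then Sum.inl (w.past K) else Sum.inr ⟦w⟧) (by
    intro w w' h
    by_cases hw : w'.Hits K
    · rw [if_pos hw, if_pos ((Traj.Hits.congr h).2 hw), Traj.past_congr h hw]
    · rw [if_neg hw, if_neg fun h' => hw ((Traj.Hits.congr h).1 h'), Quotient.sound h])

variable [MeasurableSpace V]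

variable (G) in
/-- `Ω`: the at most countable sums of Dirac masses on `W*` that give finite mass to `W_K*` for
every finite `K`. -/
def Config : Type _ :=
  {ω : Measure (TrajMod G) //
    (∃ (I : Set ℕ) (w : I → TrajMod G), ω = Measure.sum fun i => Measure.dirac (w i)) ∧
      ∀ K : Finset V, ω (hitSet G K) < ∞}

/-- The σ-algebra generated by the maps `ω ↦ ω D`, `D ⊆ W*` measurable. -/
instance : MeasurableSpace (Config G) :=
  ⨆ (D : Set (TrajMod G)) (_ : MeasurableSet D),
    MeasurableSpace.comap (fun ω : Config G => ω.1 D) inferInstance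

/-- `Out_{K→}(ω)`, a point measure on `W⁺ ⊔ W*`: the image of the point measure `ω` under
`keepFuture K`. -/
def outFuture (K : Finset V) (ω : Config G) : Measure (HalfTraj G ⊕ TrajMod G) :=
  ω.1.map (keepFuture K)

/-- `Out_{→K}(ω)`, a point measure on `W⁺ ⊔ W*`: the image of the point measure `ω` under
`keepPast K`. -/
def outPast (K : Finset V) (ω : Config G) : Measure (HalfTraj G ⊕ TrajMod G) :=
  ω.1.map (keepPast K)

variable (G) in
/-- The σ-algebra of non-local future events: the intersection over all finite `K` of
`σ(Out_{K→})`. Spaces of measures carry the σ-algebra generated by evaluations on measurable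
sets. -/
@[reducible] def futureTail : MeasurableSpace (Config G) :=
  ⨅ K : Finset V, MeasurableSpace.comap (outFuture K) Measure.instMeasurableSpace

variable (G) in
/-- The σ-algebra of non-local past events: the intersection over all finite `K` of
`σ(Out_{→K})`. -/
@[reducible] def pastTail : MeasurableSpace (Config G) :=
  ⨅ K : Finset V, MeasurableSpace.comap (outPast K) Measure.instMeasurableSpace

/-- `Pr` is the law of a Poisson point process with intensity `ν`: the numbers of points in
disjoint measurable sets are independent, and the number of points in a set `D` of finite
intensity has the Poisson distribution with parameter `ν D`. -/
structure IsPoissonProcess (ν : Measure (TrajMod G)) (Pr : Measure (Config G)) : Prop where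
  isProbabilityMeasure : IsProbabilityMeasure Pr
  poisson : ∀ D : Set (TrajMod G), MeasurableSet D → ν D < ∞ →
    Pr.map (fun ω => ω.1 D) =
      (poissonMeasure (ν D).toNNReal).map (fun k : ℕ => (k : ℝ≥0∞))
  indep : ∀ (m : ℕ) (D : Fin m → Set (TrajMod G)), (∀ i, MeasurableSet (D i)) →
    Pairwise (fun i j => Disjoint (D i) (D j)) → iIndepFun (fun i (ω : Config G) => ω.1 (D i)) Pr

end Trajectories

/-- The bi-infinite sequence with past `u` (read backwards) and future `v`; it is used for
`u 0 = v 0`. -/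
def glue (uv : (ℕ → V) × (ℕ → V)) (n : ℤ) : V :=
  if 0 ≤ n then uv.2 n.toNat else uv.1 (-n).toNat

namespace Network

variable [MeasurableSpace V] [DiscreteMeasurableSpace V] (N : Network V)

/-- The measure `ν_K` on `W`, under which the position at time `0` has law `e_K` (up to mass) and,
given that it is `x`, the past read backwards has law `P_x[· | τ_K⁺ = ∞]` and the future,
independently, has law `P_x`. -/
def nuK (K : Finset V) : Measure (Traj N.graph) :=
  Measure.comap Subtype.val
    (∑ x ∈ K, N.eqMass K x •
      (((N.P x)[|{w | returnTime (K : Set V) w = ⊤}]).prod (N.P x)).map glue)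

/-- The measure `ν` on `W*`, built from an exhaustion `K` with `K 0 = ∅` as the image under the
projection `W → W*` of `∑_{n ≥ 1} ν_{K_n} 1_{W_{K_n} \ W_{K_{n-1}}}`. -/
def nu (K : ℕ → Finset V) : Measure (TrajMod N.graph) :=
  (Measure.sum fun n : ℕ =>
    (N.nuK (K (n + 1))).restrict {w | w.Hits (K (n + 1)) ∧ ¬ w.Hits (K n)}).map (Quotient.mk _)

end Network

end Interlacement

end

/-!
Cut the trajectories of `ω` at `K_n`. Given what is kept, the trajectories that are cut visit a
finite set `B ⊆ K_n` independently of each other, with probability `q = P_y[τ_B < ∞]` where `y` is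
the starting vertex of the kept piece: for the cut that keeps futures this is the description of
`ν` seen from the last visit to `K_n`, and the cut that keeps pasts reduces to it because `ν` is
invariant under time reversal. Hence `∫ q² dν = ∑_y e_{K_n}(y) P_y[τ_B < ∞]²`, which tends to `0`:
the sums `∑_y e_{K_n}(y) P_y[τ_B < ∞]` stay bounded by the last-exit decomposition, and the
equilibrium measure of `{y | P_y[τ_x < ∞] > ε}` tends to `0` because, by reversibility, it is
bounded by the probability that the chain from `x` comes back to `x` late.

Now let `f ≥ 0` vanish off the trajectories that visit `B`, let `u ≤ q` be the conditional
expectation of `1 - e^{-f}` given the kept piece, and put `e^{-g} = 1 - u`. By the formula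
`𝔼 e^{-ω(h)} = e^{-ν(1 - e^{-h})}`, the variables `e^{-ω(f)}` and `e^{-ω(g ∘ κ)}` have the same
integral over every event of `σ(Out_{K_n})`, and the variance of the latter is at most
`1 - e^{-∫ u² dν} → 0`. So a tail event is independent of `e^{-ω(f)}` for all such `f`, hence of
itself.
-/

noncomputable section

namespace Interlacement

/-! ### Laplace functionals -/

section ExpNeg

/-- The function `x ↦ e^{-x}` on `[0, ∞]`, with `e^{-∞} = 0`. Allowing infinite
arguments, Laplace functionals make sense at every measurable nonnegative function. -/
def expNeg (x : ℝ≥0∞) : ℝ≥0∞ := EReal.exp (-(x : EReal))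

@[simp] theorem expNeg_zero : expNeg 0 = 1 := by simp [expNeg]

theorem expNeg_add (x y : ℝ≥0∞) : expNeg (x + y) = expNeg x * expNeg y := by
  rw [expNeg, EReal.coe_ennreal_add, EReal.neg_add (by simp) (by simp), sub_eq_add_neg,
    EReal.exp_add, expNeg, expNeg]

theorem expNeg_sum {ι : Type*} (s : Finset ι) (x : ι → ℝ≥0∞) :
    expNeg (∑ i ∈ s, x i) = ∏ i ∈ s, expNeg (x i) := by
  induction s using Finset.cons_induction with
  | empty => simp
  | cons i s hi ih => rw [Finset.sum_cons, Finset.prod_cons, expNeg_add, ih]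

theorem expNeg_nsmul (n : ℕ) (x : ℝ≥0∞) : expNeg (n • x) = expNeg x ^ n := by
  simpa using expNeg_sum (Finset.range n) fun _ => x

theorem expNeg_le_one (x : ℝ≥0∞) : expNeg x ≤ 1 := by
  simp [expNeg, EReal.coe_ennreal_nonneg]

theorem expNeg_ne_top (x : ℝ≥0∞) : expNeg x ≠ ∞ :=
  ne_top_of_le_ne_top ENNReal.one_ne_top (expNeg_le_one x)

theorem expNeg_injective : Function.Injective expNeg :=
  EReal.exp_strictMono.injective.comp
    (neg_injective.comp EReal.coe_ennreal_injective)

theorem continuous_expNeg : Continuous expNeg :=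
  ENNReal.continuous_exp.comp (continuous_neg.comp continuous_coe_ennreal_ereal)

@[fun_prop]
theorem measurable_expNeg : Measurable expNeg := continuous_expNeg.measurable

theorem expNeg_antitone : Antitone expNeg := fun _ _ h =>
  EReal.exp_monotone (EReal.neg_le_neg_iff.2 (EReal.coe_ennreal_le_coe_ennreal_iff.2 h))

theorem measurable_expNeg_lintegral {X : Type*} [MeasurableSpace X] {f : X → ℝ≥0∞}
    (hf : Measurable f) : Measurable fun μ : Measure X => expNeg (∫⁻ x, f x ∂μ) :=
  measurable_expNeg.comp (Measure.measurable_lintegral hf)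

theorem toReal_expNeg {x : ℝ≥0∞} (hx : x ≠ ∞) : (expNeg x).toReal = Real.exp (-x.toReal) := by
  lift x to NNReal using hx
  change (EReal.exp ((-(x : ℝ) : ℝ) : EReal)).toReal = _
  rw [EReal.exp_coe, ENNReal.toReal_ofReal (Real.exp_pos _).le, ENNReal.coe_toReal]

/-- The inverse `u ↦ -log u` of `expNeg` on `[0, 1]`. -/
def negLog (u : ℝ≥0∞) : ℝ≥0∞ := (-ENNReal.log u).toENNReal

@[fun_prop]
theorem measurable_negLog : Measurable negLog :=
  measurable_ereal_toENNReal.comp (continuous_neg.measurable.comp ENNReal.measurable_log)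

theorem expNeg_negLog {u : ℝ≥0∞} (hu : u ≤ 1) : expNeg (negLog u) = u := by
  have hlog : 0 ≤ -ENNReal.log u := by
    rw [EReal.neg_nonneg]
    exact ENNReal.log_le_zero_iff.2 hu
  rw [expNeg, negLog, EReal.coe_toENNReal hlog, neg_neg, ENNReal.exp_log]

end ExpNeg

section LaplaceUniqueness

open BoundedContinuousFunction

theorem ext_of_integral_eq_of_mem_submonoid {E : Type*} [TopologicalSpace E] [PolishSpace E]
    [MeasurableSpace E] [BorelSpace E] {P Q : Measure E} [IsFiniteMeasure P] [IsFiniteMeasure Q]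
    (S : Submonoid (E →ᵇ ℝ)) (hsep : ∀ x y, x ≠ y → ∃ φ ∈ S, φ x ≠ φ y)
    (h : ∀ φ ∈ S, ∫ x, φ x ∂P = ∫ x, φ x ∂Q) : P = Q := by
  let A : StarSubalgebra ℝ (E →ᵇ ℝ) :=
    { Algebra.adjoin ℝ (S : Set (E →ᵇ ℝ)) with
      star_mem' := fun {φ} hφ => by rwa [show star φ = φ from ext fun _ => rfl] }
  refine ext_of_forall_mem_subalgebra_integral_eq_of_polish (𝕜 := ℝ) (A := A) ?_ ?_
  · intro x y hxy
    obtain ⟨φ, hφ, hne⟩ := hsep x y hxy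
    exact ⟨φ, ⟨φ.toContinuousMap, ⟨φ, Algebra.subset_adjoin hφ, rfl⟩, rfl⟩, hne⟩
  · intro φ hφ
    have hspan : φ ∈ Submodule.span ℝ (S : Set (E →ᵇ ℝ)) := by
      rw [← S.closure_eq, ← Algebra.adjoin_eq_span]
      exact hφ
    clear hφ
    induction hspan using Submodule.span_induction with
    | mem φ hφ => exact h φ hφ
    | zero => simp
    | add φ ψ _ _ hφ hψ =>
      simp only [BoundedContinuousFunction.coe_add, Pi.add_apply]
      rw [integral_add (φ.integrable P) (ψ.integrable P),
        integral_add (φ.integrable Q) (ψ.integrable Q), hφ, hψ]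
    | smul c φ _ hφ =>
      simp only [BoundedContinuousFunction.coe_smul, integral_smul, hφ]

theorem ext_of_lintegral_expNeg_sum {ι : Type*} [Finite ι] {P Q : Measure (ι → ℝ≥0∞)}
    [IsFiniteMeasure P] [IsFiniteMeasure Q]
    (h : ∀ (s : Finset ι) (c : ι → ℕ),
      ∫⁻ x, expNeg (∑ i ∈ s, c i • x i) ∂P = ∫⁻ x, expNeg (∑ i ∈ s, c i • x i) ∂Q) :
    P = Q := by
  classical
  cases nonempty_fintype ι
  let S : Submonoid ((ι → ℝ≥0∞) →ᵇ ℝ) :=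
    { carrier := {φ | ∃ c : ι → ℕ, ∀ x, φ x = (expNeg (∑ i, c i • x i)).toReal}
      one_mem' := ⟨0, fun x => by simp⟩
      mul_mem' := by
        rintro φ ψ ⟨c, hc⟩ ⟨d, hd⟩
        exact ⟨c + d, fun x => by
          simp only [Pi.add_apply, add_smul, Finset.sum_add_distrib, expNeg_add,
            ENNReal.toReal_mul, BoundedContinuousFunction.coe_mul, Pi.mul_apply, hc, hd]⟩ }
  refine ext_of_integral_eq_of_mem_submonoid S (fun x y hxy => ?_) ?_
  · obtain ⟨i, hi⟩ := Function.ne_iff.1 hxy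
    have hcont : Continuous fun x : ι → ℝ≥0∞ => (expNeg (x i)).toReal :=
      ENNReal.continuousOn_toReal.comp_continuous
        (continuous_expNeg.comp (continuous_apply i)) fun _ => expNeg_ne_top _
    refine ⟨.mkOfCompact ⟨_, hcont⟩, ⟨Pi.single i 1, fun x => ?_⟩, fun heq => hi ?_⟩
    · simp [Pi.single_apply]
    · exact expNeg_injective
        ((ENNReal.toReal_eq_toReal_iff' (expNeg_ne_top _) (expNeg_ne_top _)).1 heq)
  · rintro φ ⟨c, hc⟩
    have hm : Measurable fun x : ι → ℝ≥0∞ => expNeg (∑ i, c i • x i) := by fun_prop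
    simp_rw [hc]
    rw [integral_toReal hm.aemeasurable (ae_of_all _ fun _ => (expNeg_ne_top _).lt_top),
      integral_toReal hm.aemeasurable (ae_of_all _ fun _ => (expNeg_ne_top _).lt_top), h]

/-- The evaluations of a measure at all measurable sets. -/
def evalSets {X : Type*} [MeasurableSpace X] (μ : Measure X) (D : {D : Set X // MeasurableSet D}) :
    ℝ≥0∞ := μ D

theorem comap_evalSets {X : Type*} [MeasurableSpace X] :
    MeasurableSpace.comap (evalSets (X := X)) MeasurableSpace.pi = Measure.instMeasurableSpace := by
  simp only [MeasurableSpace.pi, MeasurableSpace.comap_iSup, MeasurableSpace.comap_comp,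
    Measure.instMeasurableSpace, iSup_subtype]
  rfl

theorem ext_of_lintegral_expNeg_lintegral {X : Type*} [MeasurableSpace X]
    {P Q : Measure (Measure X)} [IsFiniteMeasure P] [IsFiniteMeasure Q]
    (h : ∀ f : X → ℝ≥0∞, Measurable f →
      ∫⁻ μ, expNeg (∫⁻ x, f x ∂μ) ∂P = ∫⁻ μ, expNeg (∫⁻ x, f x ∂μ) ∂Q) :
    P = Q := by
  have hm : Measurable (evalSets (X := X)) :=
    measurable_pi_lambda _ fun D => Measure.measurable_coe D.2
  have hmarginal (I : Finset {D : Set X // MeasurableSet D}) :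
      (P.map evalSets).map I.restrict = (Q.map evalSets).map I.restrict := by
    have hr : Measurable (I.restrict ∘ evalSets (X := X)) := by fun_prop
    rw [Measure.map_map (by fun_prop) hm, Measure.map_map (by fun_prop) hm]
    refine ext_of_lintegral_expNeg_sum fun s c => ?_
    have hf (i : I) : Measurable fun x => c i * i.1.1.indicator (1 : X → ℝ≥0∞) x :=
      (measurable_one.indicator i.1.2).const_mul _
    have heval (μ : Measure X) : ∑ i ∈ s, c i • (I.restrict ∘ evalSets) μ i
        = ∫⁻ x, ∑ i ∈ s, c i * i.1.1.indicator (1 : X → ℝ≥0∞) x ∂μ := by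
      rw [lintegral_finsetSum _ fun i _ => hf i]
      refine Finset.sum_congr rfl fun i _ => ?_
      rw [lintegral_const_mul _ (measurable_one.indicator i.1.2), lintegral_indicator_one i.1.2,
        nsmul_eq_mul]
      rfl
    rw [lintegral_map (by fun_prop) hr, lintegral_map (by fun_prop) hr]
    simp_rw [heval]
    exact h _ (Finset.measurable_sum _ fun i _ => hf i)
  have hmap : P.map evalSets = Q.map evalSets :=
    IsProjectiveLimit.unique (P := fun I => (Q.map evalSets).map I.restrict) hmarginal fun _ => rfl
  ext A hA
  rw [← comap_evalSets] at hA
  obtain ⟨B, hB, rfl⟩ := hA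
  rw [← Measure.map_apply hm hB, ← Measure.map_apply hm hB, hmap]

end LaplaceUniqueness

/-! ### Poisson random measures -/

section PoissonLaplace

open scoped NNReal

theorem lintegral_pow_poissonMeasure (r : ℝ≥0) {z : ℝ≥0∞} (hz : z ≤ 1) :
    ∫⁻ k, z ^ k ∂poissonMeasure r = expNeg ((1 - z) * r) := by
  lift z to ℝ≥0 using ne_top_of_le_ne_top ENNReal.one_ne_top hz
  have hz' : z ≤ 1 := by exact_mod_cast hz
  have hint : Integrable (fun k : ℕ => ((z ^ k : ℝ≥0) : ℝ)) (poissonMeasure r) :=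
    .of_bound (C := 1) .of_discrete
      (ae_of_all _ fun k => by simpa using pow_le_one₀ z.coe_nonneg hz')
  have hexp : ∫ k : ℕ, ((z ^ k : ℝ≥0) : ℝ) ∂poissonMeasure r = Real.exp (-((1 - z) * r)) := by
    have hseries := (NormedSpace.expSeries_div_hasSum_exp ((r : ℝ) * z)).mul_left (Real.exp (-r))
    rw [← Real.exp_eq_exp_ℝ, ← Real.exp_add] at hseries
    rw [integral_poissonMeasure, show -((1 - z) * r : ℝ) = -r + r * z by ring, ← hseries.tsum_eq]
    refine tsum_congr fun k => ?_
    rw [smul_eq_mul, NNReal.coe_pow, mul_pow]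
    ring
  calc ∫⁻ k, (z : ℝ≥0∞) ^ k ∂poissonMeasure r
      = ∫⁻ k, ((z ^ k : ℝ≥0) : ℝ≥0∞) ∂poissonMeasure r := by simp
    _ = ENNReal.ofReal (Real.exp (-((1 - z) * r))) := by
        rw [lintegral_coe_eq_integral _ hint, hexp]
    _ = expNeg ((1 - z) * r) := by
        have hfin : (1 - z : ℝ≥0∞) * r ≠ ∞ := by finiteness
        rw [← ENNReal.ofReal_toReal (expNeg_ne_top ((1 - z) * r)), toReal_expNeg hfin,
          ENNReal.toReal_mul, ENNReal.toReal_sub_of_le hz ENNReal.one_ne_top]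
        simp

/-- A Poisson random measure of intensity `ν`, as a random variable `η` with values in the space of
measures. -/
structure IsPoissonRandomMeasure {X Ω : Type*} [MeasurableSpace X] [MeasurableSpace Ω]
    (ν : Measure X) (η : Ω → Measure X) (Pr : Measure Ω) : Prop where
  measurable : Measurable η
  map_count : ∀ D : Set X, MeasurableSet D → ν D < ∞ →
    Pr.map (fun ω => η ω D) = (poissonMeasure (ν D).toNNReal).map (fun k : ℕ => (k : ℝ≥0∞))
  iIndepFun_count : ∀ (m : ℕ) (D : Fin m → Set X), (∀ i, MeasurableSet (D i)) →
    Pairwise (fun i j => Disjoint (D i) (D j)) → iIndepFun (fun i ω => η ω (D i)) Pr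

namespace IsPoissonRandomMeasure

variable {X Ω : Type*} [MeasurableSpace X] [MeasurableSpace Ω] {ν : Measure X} {η : Ω → Measure X}
  {Pr : Measure Ω}

protected theorem isProbabilityMeasure (h : IsPoissonRandomMeasure ν η Pr) :
    IsProbabilityMeasure Pr :=
  (h.iIndepFun_count 0 Fin.elim0 (fun i => i.elim0) fun i => i.elim0).isProbabilityMeasure

theorem lintegral_expNeg_count (h : IsPoissonRandomMeasure ν η Pr) {D : Set X}
    (hD : MeasurableSet D) (hνD : ν D ≠ ∞) (c : ℝ≥0∞) :
    ∫⁻ ω, expNeg (c * η ω D) ∂Pr = expNeg ((1 - expNeg c) * ν D) := by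
  have hη : Measurable fun ω => η ω D := (Measure.measurable_coe hD).comp h.measurable
  rw [← lintegral_map (f := fun y => expNeg (c * y)) (by fun_prop) hη,
    h.map_count D hD hνD.lt_top, lintegral_map (by fun_prop) .of_discrete]
  simp_rw [mul_comm c, ← nsmul_eq_mul, expNeg_nsmul]
  rw [lintegral_pow_poissonMeasure _ (expNeg_le_one c), ENNReal.coe_toNNReal hνD]

theorem iIndepFun_count_of_finite (h : IsPoissonRandomMeasure ν η Pr) {ι : Type*} [Finite ι]
    {D : ι → Set X} (hD : ∀ i, MeasurableSet (D i)) (hdisj : Pairwise (Function.onFun Disjoint D)) :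
    iIndepFun (fun i ω => η ω (D i)) Pr := by
  obtain ⟨m, ⟨e⟩⟩ := Finite.exists_equiv_fin ι
  have hfin := h.iIndepFun_count m (D ∘ e.symm) (fun _ => hD _)
    fun _ _ hij => hdisj (e.symm.injective.ne hij)
  simpa using hfin.precomp e.injective

theorem lintegral_expNeg_simpleFunc (h : IsPoissonRandomMeasure ν η Pr)
    (f : SimpleFunc X ℝ≥0∞) (hf : f.FinMeasSupp ν) :
    ∫⁻ ω, expNeg (∫⁻ x, f x ∂η ω) ∂Pr = expNeg (∫⁻ x, 1 - expNeg (f x) ∂ν) := by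
  have hprob := h.isProbabilityMeasure
  have hdisj : Pairwise (Function.onFun Disjoint fun c : f.range => f ⁻¹' {(c : ℝ≥0∞)}) :=
    fun c d hcd => Disjoint.preimage f (by simpa using Subtype.coe_ne_coe.2 hcd)
  have hcount (c : ℝ≥0∞) : Measurable fun ω => η ω (f ⁻¹' {c}) :=
    (Measure.measurable_coe (f.measurableSet_fiber c)).comp h.measurable
  have hindep : iIndepFun (fun (c : f.range) ω => expNeg (c * η ω (f ⁻¹' {(c : ℝ≥0∞)}))) Pr :=
    (h.iIndepFun_count_of_finite (fun c => f.measurableSet_fiber _) hdisj).comp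
      (fun (c : f.range) y => expNeg (c * y)) fun c => by fun_prop
  have hfiber (c : ℝ≥0∞) : ∫⁻ ω, expNeg (c * η ω (f ⁻¹' {c})) ∂Pr
      = expNeg ((1 - expNeg c) * ν (f ⁻¹' {c})) := by
    rcases eq_or_ne c 0 with rfl | hc
    · simp
    · exact h.lintegral_expNeg_count (f.measurableSet_fiber c)
        (hf.meas_preimage_singleton_ne_zero hc).ne c
  have hmap : ∫⁻ x, 1 - expNeg (f x) ∂ν = ∑ c ∈ f.range, (1 - expNeg c) * ν (f ⁻¹' {c}) := by
    rw [← SimpleFunc.map_lintegral (fun c => 1 - expNeg c), ← SimpleFunc.lintegral_eq_lintegral]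
    rfl
  calc ∫⁻ ω, expNeg (∫⁻ x, f x ∂η ω) ∂Pr
      = ∫⁻ ω, ∏ c : f.range, expNeg (c * η ω (f ⁻¹' {(c : ℝ≥0∞)})) ∂Pr := by
        simp_rw [f.lintegral_eq_lintegral, SimpleFunc.lintegral, ← Finset.sum_coe_sort f.range,
          expNeg_sum]
    _ = ∏ c : f.range, ∫⁻ ω, expNeg (c * η ω (f ⁻¹' {(c : ℝ≥0∞)})) ∂Pr :=
        lintegral_prod_eq_prod_lintegral_of_indepFun _ _ hindep fun c => by fun_prop
    _ = expNeg (∫⁻ x, 1 - expNeg (f x) ∂ν) := by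
        rw [hmap, ← Finset.sum_coe_sort f.range, expNeg_sum]
        exact Finset.prod_congr rfl fun c _ => hfiber c

theorem lintegral_expNeg [SigmaFinite ν] (h : IsPoissonRandomMeasure ν η Pr) {f : X → ℝ≥0∞}
    (hf : Measurable f) :
    ∫⁻ ω, expNeg (∫⁻ x, f x ∂η ω) ∂Pr = expNeg (∫⁻ x, 1 - expNeg (f x) ∂ν) := by
  have hprob := h.isProbabilityMeasure
  have hspan (n : ℕ) : MeasurableSet (spanningSets ν n) := measurableSet_spanningSets ν n
  let s (n : ℕ) : SimpleFunc X ℝ≥0∞ := (SimpleFunc.eapprox f n).restrict (spanningSets ν n)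
  have hs (n : ℕ) (x : X) : s n x = (spanningSets ν n).indicator (SimpleFunc.eapprox f n) x :=
    SimpleFunc.restrict_apply _ (hspan n) x
  have hs_mono (x : X) : Monotone fun n => s n x := fun m n hmn => by
    simp_rw [hs]
    exact (Set.indicator_le_indicator_of_subset (monotone_spanningSets ν hmn)
      (fun _ => zero_le) x).trans (Set.indicator_le_indicator (SimpleFunc.monotone_eapprox f hmn x))
  have hs_tendsto (x : X) : Tendsto (fun n => s n x) atTop (𝓝 (f x)) := by
    refine (SimpleFunc.tendsto_eapprox hf x).congr' ?_
    filter_upwards [eventually_mem_spanningSets ν x] with n hn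
    rw [hs, Set.indicator_of_mem hn]
  have hs_fin (n : ℕ) : (s n).FinMeasSupp ν := SimpleFunc.finMeasSupp_iff_support.2 <|
    (measure_mono fun x hx => by
      by_contra hxn
      exact hx ((hs n x).trans (Set.indicator_of_notMem hxn _))).trans_lt
      (measure_spanningSets_lt_top ν n)
  refine tendsto_nhds_unique (f := fun n => ∫⁻ ω, expNeg (∫⁻ x, s n x ∂η ω) ∂Pr) (l := atTop) ?_ ?_
  · refine tendsto_lintegral_of_dominated_convergence 1 (fun n => ?_)
      (fun n => ae_of_all _ fun ω => expNeg_le_one _) (by simp) (ae_of_all _ fun ω => ?_)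
    · exact (measurable_expNeg_lintegral (s n).measurable).comp h.measurable
    · exact (continuous_expNeg.tendsto _).comp (lintegral_tendsto_of_tendsto_of_monotone
        (fun n => (s n).measurable.aemeasurable) (ae_of_all _ hs_mono) (ae_of_all _ hs_tendsto))
  · simp_rw [h.lintegral_expNeg_simpleFunc _ (hs_fin _)]
    refine (continuous_expNeg.tendsto _).comp (lintegral_tendsto_of_tendsto_of_monotone
      (fun n => by fun_prop) (ae_of_all _ fun x m n hmn => ?_) (ae_of_all _ fun x => ?_))
    · exact tsub_le_tsub_left (expNeg_antitone (hs_mono x hmn)) 1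
    · exact ((ENNReal.continuous_sub_left ENNReal.one_ne_top).comp
        continuous_expNeg).continuousAt.tendsto.comp (hs_tendsto x)

end IsPoissonRandomMeasure

end PoissonLaplace

/-! ### A zero-one law for Poisson random measures -/

section ZeroOne

theorem exists_eq_withDensity_of_le_withDensity {T : Type*} [MeasurableSpace T] {μ ρ : Measure T}
    {q : T → ℝ≥0∞} (hq : Measurable q) [IsFiniteMeasure (μ.withDensity q)]
    (hρ : ρ ≤ μ.withDensity q) : ∃ u, Measurable u ∧ u ≤ q ∧ ρ = μ.withDensity u := by
  have : IsFiniteMeasure ρ := isFiniteMeasure_of_le _ hρ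
  let v := fun t => min (ρ.rnDeriv (μ.withDensity q) t) 1
  have hv : Measurable v := (Measure.measurable_rnDeriv _ _).min measurable_const
  have hv_ae : ρ.rnDeriv (μ.withDensity q) =ᵐ[μ.withDensity q] v := by
    filter_upwards [Measure.rnDeriv_le_one_of_le hρ] with t ht
    exact (min_eq_left ht).symm
  refine ⟨q * v, hq.mul hv, fun t => mul_le_of_le_one_right' (min_le_right _ _), ?_⟩
  rw [withDensity_mul _ hq hv, ← withDensity_congr_ae hv_ae,
    Measure.withDensity_rnDeriv_eq _ _ (Measure.absolutelyContinuous_of_le hρ)]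

theorem memLp_toReal_of_le_one {Ω : Type*} [MeasurableSpace Ω] {P : Measure Ω} [IsFiniteMeasure P]
    {Z : Ω → ℝ≥0∞} (hZ : Measurable Z) (hZ1 : ∀ ω, Z ω ≤ 1) {p : ℝ≥0∞} :
    MemLp (fun ω => (Z ω).toReal) p P :=
  .of_bound hZ.ennreal_toReal.aestronglyMeasurable 1 (ae_of_all _ fun ω => by
    simpa using ENNReal.toReal_mono ENNReal.one_ne_top (hZ1 ω))

theorem sq_setIntegral_sub_le_variance {Ω : Type*} [MeasurableSpace Ω] {P : Measure Ω}
    [IsProbabilityMeasure P] {Y : Ω → ℝ} (hY : MemLp Y 2 P) {E : Set Ω} (hE : MeasurableSet E) :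
    (∫ ω in E, Y ω ∂P - P.real E * ∫ ω, Y ω ∂P) ^ 2 ≤ Var[Y; P] := by
  let D : Ω → ℝ := fun ω => Y ω - P[Y]
  have hD : MemLp D 2 P := hY.sub (memLp_const _)
  have hmean : ∫ ω, E.indicator D ω ∂P = ∫ ω in E, Y ω ∂P - P.real E * ∫ ω, Y ω ∂P := by
    rw [integral_indicator hE, integral_sub (hY.integrable one_le_two).integrableOn
      (integrable_const _).integrableOn]
    simp
  have hsq : (E.indicator D) ^ 2 = E.indicator (D ^ 2) := by
    ext ω
    by_cases hω : ω ∈ E <;> simp [hω]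
  have hvar := variance_nonneg (E.indicator D) P
  rw [variance_eq_sub (hD.indicator hE), hmean, hsq, integral_indicator hE] at hvar
  calc (∫ ω in E, Y ω ∂P - P.real E * ∫ ω, Y ω ∂P) ^ 2
      ≤ ∫ ω in E, D ω ^ 2 ∂P := by simpa using hvar
    _ ≤ ∫ ω, D ω ^ 2 ∂P :=
        setIntegral_le_integral hD.integrable_sq (ae_of_all _ fun _ => sq_nonneg _)
    _ = Var[Y; P] := (variance_eq_integral hY.aemeasurable).symm

variable {X T Ω : Type*} [MeasurableSpace X] [MeasurableSpace T] [MeasurableSpace Ω]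
  {ν : Measure X} {η : Ω → Measure X} {Pr : Measure Ω} {κ : X → T} {f : X → ℝ≥0∞} {u : T → ℝ≥0∞}

theorem one_sub_mul_eq_add {a b : ℝ≥0∞} (ha : a ≤ 1) (hb : b ≤ 1) :
    1 - a * b = 1 - b + (1 - a) * b := by
  rw [ENNReal.sub_mul (by simp [ne_top_of_le_ne_top ENNReal.one_ne_top hb]), one_mul,
    tsub_add_tsub_cancel hb (mul_le_of_le_one_left' ha)]

theorem lintegral_one_sub_expNeg_add (hκ : Measurable κ) (hf : Measurable f) (hu : Measurable u)
    (hu1 : u ≤ 1)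
    (hfu : (ν.withDensity fun x => 1 - expNeg (f x)).map κ = (ν.map κ).withDensity u)
    {k : T → ℝ≥0∞} (hk : Measurable k) :
    ∫⁻ x, 1 - expNeg (f x + k (κ x)) ∂ν = ∫⁻ x, 1 - expNeg (negLog (1 - u (κ x)) + k (κ x)) ∂ν := by
  have hu_expNeg (t : T) : expNeg (negLog (1 - u t)) = 1 - u t := expNeg_negLog tsub_le_self
  have hkf : ∫⁻ x, (1 - expNeg (f x)) * expNeg (k (κ x)) ∂ν = ∫⁻ x, u (κ x) * expNeg (k (κ x)) ∂ν :=
    calc ∫⁻ x, (1 - expNeg (f x)) * expNeg (k (κ x)) ∂ν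
        = ∫⁻ t, expNeg (k t) ∂(ν.withDensity fun x => 1 - expNeg (f x)).map κ := by
          rw [lintegral_map (by fun_prop) hκ,
            lintegral_withDensity_eq_lintegral_mul _ (by fun_prop) (by fun_prop)]
          rfl
      _ = ∫⁻ x, u (κ x) * expNeg (k (κ x)) ∂ν := by
          rw [hfu, lintegral_withDensity_eq_lintegral_mul _ hu (by fun_prop),
            lintegral_map (by fun_prop) hκ]
          rfl
  calc ∫⁻ x, 1 - expNeg (f x + k (κ x)) ∂ν
      = ∫⁻ x, 1 - expNeg (k (κ x)) ∂ν + ∫⁻ x, (1 - expNeg (f x)) * expNeg (k (κ x)) ∂ν := by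
        rw [← lintegral_add_left (by fun_prop)]
        simp_rw [expNeg_add, one_sub_mul_eq_add (expNeg_le_one _) (expNeg_le_one _)]
    _ = ∫⁻ x, 1 - expNeg (negLog (1 - u (κ x)) + k (κ x)) ∂ν := by
        rw [hkf, ← lintegral_add_left (by fun_prop)]
        simp_rw [expNeg_add, one_sub_mul_eq_add (expNeg_le_one _) (expNeg_le_one _), hu_expNeg,
          ENNReal.sub_sub_cancel ENNReal.one_ne_top (hu1 _)]

theorem map_restrict_eq_smul_map [IsFiniteMeasure Pr] (hη : Measurable η) {H : ℕ → Set X}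
    (hH : Monotone H) (hHm : ∀ m, MeasurableSet (H m)) (hHU : ⋃ m, H m = Set.univ) {E : Set Ω}
    (hE : ∀ f : X → ℝ≥0∞, Measurable f → (∃ m, f.support ⊆ H m) →
      ∫⁻ ω in E, expNeg (∫⁻ x, f x ∂η ω) ∂Pr = Pr E * ∫⁻ ω, expNeg (∫⁻ x, f x ∂η ω) ∂Pr) :
    (Pr.restrict E).map η = Pr E • Pr.map η := by
  have := Measure.smul_finite (Pr.map η) (measure_ne_top Pr E)
  refine ext_of_lintegral_expNeg_lintegral fun f hf => ?_
  let F : ℕ → X → ℝ≥0∞ := fun m => (H m).indicator f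
  have hF (m : ℕ) : Measurable (F m) := hf.indicator (hHm m)
  have hF_mono (x : X) : Monotone fun m => F m x := fun m n hmn =>
    Set.indicator_le_indicator_of_subset (hH hmn) (fun _ => zero_le) x
  have hF_tendsto (x : X) : Tendsto (fun m => F m x) atTop (𝓝 (f x)) := by
    have hmono := (hH.tendsto_indicator H f x).mono_right (pure_le_nhds _)
    rwa [hHU, Set.indicator_univ] at hmono
  have hlim (Q : Measure Ω) [IsFiniteMeasure Q] :
      Tendsto (fun m => ∫⁻ ω, expNeg (∫⁻ x, F m x ∂η ω) ∂Q) atTop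
        (𝓝 (∫⁻ ω, expNeg (∫⁻ x, f x ∂η ω) ∂Q)) := by
    refine tendsto_lintegral_of_dominated_convergence 1
      (fun m => (measurable_expNeg_lintegral (hF m)).comp hη)
      (fun m => ae_of_all _ fun ω => expNeg_le_one _) (by simp) (ae_of_all _ fun ω => ?_)
    exact (continuous_expNeg.tendsto _).comp (lintegral_tendsto_of_tendsto_of_monotone
      (fun m => (hF m).aemeasurable) (ae_of_all _ hF_mono) (ae_of_all _ hF_tendsto))
  rw [lintegral_smul_measure, smul_eq_mul,
    lintegral_map (measurable_expNeg_lintegral hf) hη,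
    lintegral_map (measurable_expNeg_lintegral hf) hη]
  refine tendsto_nhds_unique ?_
    (ENNReal.Tendsto.const_mul (hlim Pr) (Or.inr (measure_ne_top Pr E)))
  simp_rw [← hE _ (hF _) ⟨_, Set.support_indicator_subset⟩]
  exact hlim (Pr.restrict E)

namespace IsPoissonRandomMeasure

section SigmaFinite

variable [SigmaFinite ν]

theorem lintegral_expNeg_map_withDensity (h : IsPoissonRandomMeasure ν η Pr) (hκ : Measurable κ)
    (hf : Measurable f) {k : T → ℝ≥0∞} (hk : Measurable k) :
    ∫⁻ μ, expNeg (∫⁻ t, k t ∂μ)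
        ∂(Pr.withDensity fun ω => expNeg (∫⁻ x, f x ∂η ω)).map (fun ω => (η ω).map κ)
      = expNeg (∫⁻ x, 1 - expNeg (f x + k (κ x)) ∂ν) := by
  have hκη : Measurable fun ω => (η ω).map κ := (Measure.measurable_map κ hκ).comp h.measurable
  have hlapf : Measurable fun ω => expNeg (∫⁻ x, f x ∂η ω) :=
    (measurable_expNeg_lintegral hf).comp h.measurable
  have hlapk : Measurable fun ω => expNeg (∫⁻ t, k t ∂(η ω).map κ) :=
    (measurable_expNeg_lintegral hk).comp hκη
  rw [lintegral_map (measurable_expNeg_lintegral hk) hκη,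
    lintegral_withDensity_eq_lintegral_mul _ hlapf hlapk, ← h.lintegral_expNeg (by fun_prop)]
  refine lintegral_congr fun ω => ?_
  rw [Pi.mul_apply, lintegral_map hk hκ, ← expNeg_add, lintegral_add_left hf]

theorem setLIntegral_expNeg_eq (h : IsPoissonRandomMeasure ν η Pr) (hκ : Measurable κ)
    (hf : Measurable f) (hu : Measurable u) (hu1 : u ≤ 1)
    (hfu : (ν.withDensity fun x => 1 - expNeg (f x)).map κ = (ν.map κ).withDensity u)
    {E : Set Ω} (hE : MeasurableSet[.comap (fun ω => (η ω).map κ) inferInstance] E) :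
    ∫⁻ ω in E, expNeg (∫⁻ x, f x ∂η ω) ∂Pr
      = ∫⁻ ω in E, expNeg (∫⁻ x, negLog (1 - u (κ x)) ∂η ω) ∂Pr := by
  have hprob := h.isProbabilityMeasure
  have hκη : Measurable fun ω => (η ω).map κ := (Measure.measurable_map κ hκ).comp h.measurable
  have hfin (g : X → ℝ≥0∞) :
      IsFiniteMeasure (Pr.withDensity fun ω => expNeg (∫⁻ x, g x ∂η ω)) :=
    isFiniteMeasure_withDensity <| ne_top_of_le_ne_top (by simp : ∫⁻ _, 1 ∂Pr ≠ ∞)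
      (lintegral_mono fun _ => expNeg_le_one _)
  have hlaw : (Pr.withDensity fun ω => expNeg (∫⁻ x, f x ∂η ω)).map (fun ω => (η ω).map κ)
      = (Pr.withDensity fun ω => expNeg (∫⁻ x, negLog (1 - u (κ x)) ∂η ω)).map
          (fun ω => (η ω).map κ) := by
    have := hfin f
    have := hfin fun x => negLog (1 - u (κ x))
    refine ext_of_lintegral_expNeg_lintegral fun k hk => ?_
    rw [h.lintegral_expNeg_map_withDensity hκ hf hk,
      h.lintegral_expNeg_map_withDensity hκ (by fun_prop) hk,
      lintegral_one_sub_expNeg_add hκ hf hu hu1 hfu hk]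
  obtain ⟨S, hS, rfl⟩ := hE
  rw [← withDensity_apply _ (hκη hS), ← withDensity_apply _ (hκη hS), ← Measure.map_apply hκη hS,
    hlaw, Measure.map_apply hκη hS]

theorem variance_expNeg_le (h : IsPoissonRandomMeasure ν η Pr) {v : X → ℝ≥0∞} (hv : Measurable v)
    (hv1 : v ≤ 1) :
    Var[fun ω => (expNeg (∫⁻ x, negLog (1 - v x) ∂η ω)).toReal; Pr]
      ≤ 1 - (expNeg (∫⁻ x, v x ^ 2 ∂ν)).toReal := by
  have hprob := h.isProbabilityMeasure
  let Z : Ω → ℝ≥0∞ := fun ω => expNeg (∫⁻ x, negLog (1 - v x) ∂η ω)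
  have hZ : Measurable Z := (measurable_expNeg_lintegral (by fun_prop)).comp h.measurable
  have hZ_lt_top : ∀ᵐ ω ∂Pr, Z ω < ∞ := ae_of_all _ fun _ => (expNeg_ne_top _).lt_top
  have hvv (x : X) : 1 - (1 - v x) * (1 - v x) + v x ^ 2 = v x + v x := by
    rw [one_sub_mul_eq_add tsub_le_self tsub_le_self,
      ENNReal.sub_sub_cancel ENNReal.one_ne_top (hv1 x), sq, add_assoc, ← mul_add,
      tsub_add_cancel_of_le (show v x ≤ 1 from hv1 x), mul_one]
  have hmean : ∫⁻ ω, Z ω ∂Pr = expNeg (∫⁻ x, v x ∂ν) := by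
    simp_rw [Z, h.lintegral_expNeg (f := fun x => negLog (1 - v x)) (by fun_prop),
      expNeg_negLog tsub_le_self, ENNReal.sub_sub_cancel ENNReal.one_ne_top (hv1 _)]
  have hsecond : ∫⁻ ω, Z ω ^ 2 ∂Pr = expNeg (∫⁻ x, 1 - (1 - v x) * (1 - v x) ∂ν) := by
    simp_rw [Z, sq, ← expNeg_add, ← lintegral_add_left
      (show Measurable fun x => negLog (1 - v x) by fun_prop)]
    rw [h.lintegral_expNeg (by fun_prop)]
    simp_rw [expNeg_add, expNeg_negLog tsub_le_self]
  have hfactor : (∫⁻ ω, Z ω ∂Pr) ^ 2 = (∫⁻ ω, Z ω ^ 2 ∂Pr) * expNeg (∫⁻ x, v x ^ 2 ∂ν) := by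
    rw [hmean, hsecond, sq, ← expNeg_add, ← expNeg_add, ← lintegral_add_left hv,
      ← lintegral_add_left (by fun_prop)]
    simp_rw [hvv]
  have hsecond_le : (∫⁻ ω, Z ω ^ 2 ∂Pr).toReal ≤ 1 := by
    rw [hsecond]
    exact ENNReal.toReal_mono ENNReal.one_ne_top (expNeg_le_one _)
  have hlast_le : (expNeg (∫⁻ x, v x ^ 2 ∂ν)).toReal ≤ 1 :=
    ENNReal.toReal_mono ENNReal.one_ne_top (expNeg_le_one _)
  calc Var[fun ω => (Z ω).toReal; Pr]
      = (∫⁻ ω, Z ω ^ 2 ∂Pr).toReal - ((∫⁻ ω, Z ω ∂Pr) ^ 2).toReal := by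
        rw [variance_eq_sub (memLp_toReal_of_le_one hZ fun _ => expNeg_le_one _),
          ENNReal.toReal_pow, integral_toReal hZ.aemeasurable hZ_lt_top,
          ← integral_toReal (hZ.pow_const 2).aemeasurable
            (hZ_lt_top.mono fun _ hω => ENNReal.pow_lt_top hω)]
        simp
    _ = (∫⁻ ω, Z ω ^ 2 ∂Pr).toReal * (1 - (expNeg (∫⁻ x, v x ^ 2 ∂ν)).toReal) := by
        rw [hfactor, ENNReal.toReal_mul]
        ring
    _ ≤ 1 - (expNeg (∫⁻ x, v x ^ 2 ∂ν)).toReal :=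
        mul_le_of_le_one_left (sub_nonneg.2 hlast_le) hsecond_le

theorem sq_setLIntegral_expNeg_sub_le (h : IsPoissonRandomMeasure ν η Pr) (hκ : Measurable κ)
    (hf : Measurable f) (hu : Measurable u) (hu1 : u ≤ 1)
    (hfu : (ν.withDensity fun x => 1 - expNeg (f x)).map κ = (ν.map κ).withDensity u)
    {E : Set Ω} (hE : MeasurableSet[.comap (fun ω => (η ω).map κ) inferInstance] E) :
    ((∫⁻ ω in E, expNeg (∫⁻ x, f x ∂η ω) ∂Pr).toReal
        - Pr.real E * (∫⁻ ω, expNeg (∫⁻ x, f x ∂η ω) ∂Pr).toReal) ^ 2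
      ≤ 1 - (expNeg (∫⁻ x, u (κ x) ^ 2 ∂ν)).toReal := by
  have hprob := h.isProbabilityMeasure
  have hκη : Measurable fun ω => (η ω).map κ := (Measure.measurable_map κ hκ).comp h.measurable
  let Z : Ω → ℝ≥0∞ := fun ω => expNeg (∫⁻ x, negLog (1 - u (κ x)) ∂η ω)
  have hZ : Measurable Z := (measurable_expNeg_lintegral (by fun_prop)).comp h.measurable
  have htotal := h.setLIntegral_expNeg_eq hκ hf hu hu1 hfu .univ
  simp only [Measure.restrict_univ] at htotal
  rw [h.setLIntegral_expNeg_eq hκ hf hu hu1 hfu hE, htotal,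
    ← integral_toReal hZ.aemeasurable (ae_of_all _ fun _ => (expNeg_ne_top _).lt_top),
    ← integral_toReal hZ.aemeasurable (ae_of_all _ fun _ => (expNeg_ne_top _).lt_top)]
  exact (sq_setIntegral_sub_le_variance (memLp_toReal_of_le_one hZ fun _ => expNeg_le_one _)
    (hκη.comap_le E hE)).trans
      (h.variance_expNeg_le (hu.comp hκ) fun x => hu1 (κ x))

theorem sq_setLIntegral_expNeg_sub_le_of_support_subset (h : IsPoissonRandomMeasure ν η Pr)
    (hκ : Measurable κ) {H : Set X} (hH : MeasurableSet H) (hνH : ν H ≠ ∞) {q : T → ℝ≥0∞}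
    (hq : Measurable q) (hq1 : q ≤ 1)
    (hqd : (ν.restrict H).map κ = (ν.map κ).withDensity q) {E : Set Ω}
    (hE : MeasurableSet[.comap (fun ω => (η ω).map κ) inferInstance] E)
    (hf : Measurable f) (hfH : f.support ⊆ H) :
    ((∫⁻ ω in E, expNeg (∫⁻ x, f x ∂η ω) ∂Pr).toReal
        - Pr.real E * (∫⁻ ω, expNeg (∫⁻ x, f x ∂η ω) ∂Pr).toReal) ^ 2
      ≤ 1 - (expNeg (∫⁻ t, q t ^ 2 ∂ν.map κ)).toReal := by
  have hle : ν.withDensity (fun x => 1 - expNeg (f x)) ≤ ν.restrict H := by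
    rw [← withDensity_indicator_one hH]
    refine withDensity_mono (ae_of_all _ fun x => ?_)
    by_cases hx : x ∈ H
    · simp [hx]
    · simp [Function.notMem_support.1 fun hfx => hx (hfH hfx)]
  have hfin : IsFiniteMeasure ((ν.map κ).withDensity q) := by
    have : IsFiniteMeasure (ν.restrict H) := isFiniteMeasure_restrict.2 hνH
    rw [← hqd]
    infer_instance
  obtain ⟨u, hu, huq, hfu⟩ :=
    exists_eq_withDensity_of_le_withDensity hq (hqd ▸ Measure.map_mono hle hκ)
  have hsq : ∫⁻ x, u (κ x) ^ 2 ∂ν ≤ ∫⁻ t, q t ^ 2 ∂ν.map κ := by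
    rw [lintegral_map (by fun_prop) hκ]
    exact lintegral_mono fun x => pow_le_pow_left' (huq _) 2
  exact (h.sq_setLIntegral_expNeg_sub_le hκ hf hu (huq.trans hq1) hfu hE).trans
    (sub_le_sub_left (ENNReal.toReal_mono (expNeg_ne_top _) (expNeg_antitone hsq)) 1)

theorem setLIntegral_expNeg_eq_mul (h : IsPoissonRandomMeasure ν η Pr) {κ : ℕ → X → T}
    (hκ : ∀ n, Measurable (κ n)) {H : Set X} (hH : MeasurableSet H) (hνH : ν H ≠ ∞)
    {q : ℕ → T → ℝ≥0∞} (hq : ∀ n, Measurable (q n)) (hq1 : ∀ n, q n ≤ 1)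
    (hqd : ∀ᶠ n in atTop, (ν.restrict H).map (κ n) = (ν.map (κ n)).withDensity (q n))
    (hq0 : Tendsto (fun n => ∫⁻ t, q n t ^ 2 ∂ν.map (κ n)) atTop (𝓝 0)) {E : Set Ω}
    (hE : ∀ n, MeasurableSet[.comap (fun ω => (η ω).map (κ n)) inferInstance] E)
    (hf : Measurable f) (hfH : f.support ⊆ H) :
    ∫⁻ ω in E, expNeg (∫⁻ x, f x ∂η ω) ∂Pr = Pr E * ∫⁻ ω, expNeg (∫⁻ x, f x ∂η ω) ∂Pr := by
  have hprob := h.isProbabilityMeasure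
  have hne_top (Q : Measure Ω) [IsFiniteMeasure Q] : ∫⁻ ω, expNeg (∫⁻ x, f x ∂η ω) ∂Q ≠ ∞ :=
    ne_top_of_le_ne_top (by simp : ∫⁻ _, 1 ∂Q ≠ ∞) (lintegral_mono fun _ => expNeg_le_one _)
  have hlim : Tendsto (fun n => 1 - (expNeg (∫⁻ t, q n t ^ 2 ∂ν.map (κ n))).toReal) atTop
      (𝓝 0) := by
    simpa using ((ENNReal.tendsto_toReal (expNeg_ne_top 0)).comp
      ((continuous_expNeg.tendsto 0).comp hq0)).const_sub 1
  have hzero := pow_eq_zero_iff two_ne_zero |>.1 (le_antisymm (ge_of_tendsto hlim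
    (hqd.mono fun n hn => h.sq_setLIntegral_expNeg_sub_le_of_support_subset (hκ n) hH hνH (hq n)
      (hq1 n) hn (hE n) hf hfH)) (sq_nonneg _))
  rw [← ENNReal.toReal_eq_toReal_iff' (hne_top _)
    (ENNReal.mul_ne_top (measure_ne_top Pr E) (hne_top Pr)), ENNReal.toReal_mul]
  exact sub_eq_zero.1 hzero

end SigmaFinite

theorem zero_one (h : IsPoissonRandomMeasure ν η Pr) {H : ℕ → Set X} (hH : Monotone H)
    (hHm : ∀ m, MeasurableSet (H m)) (hHU : ⋃ m, H m = Set.univ) (hHν : ∀ m, ν (H m) ≠ ∞)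
    {κ : ℕ → X → T} (hκ : ∀ n, Measurable (κ n))
    {q : ℕ → ℕ → T → ℝ≥0∞} (hq : ∀ m n, Measurable (q m n)) (hq1 : ∀ m n, q m n ≤ 1)
    (hqd : ∀ m, ∀ᶠ n in atTop,
      (ν.restrict (H m)).map (κ n) = (ν.map (κ n)).withDensity (q m n))
    (hq0 : ∀ m, Tendsto (fun n => ∫⁻ t, q m n t ^ 2 ∂ν.map (κ n)) atTop (𝓝 0)) {E : Set Ω}
    (hE : ∀ n, MeasurableSet[.comap (fun ω => (η ω).map (κ n)) inferInstance] E) :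
    Pr E = 0 ∨ Pr E = 1 := by
  have hprob := h.isProbabilityMeasure
  have hσ : SigmaFinite ν := ⟨⟨⟨H, fun _ => trivial, fun m => (hHν m).lt_top, hHU⟩⟩⟩
  have hlaw : (Pr.restrict E).map η = Pr E • Pr.map η :=
    map_restrict_eq_smul_map h.measurable hH hHm hHU fun f hf ⟨m, hfm⟩ =>
      h.setLIntegral_expNeg_eq_mul hκ (hHm m) (hHν m) (hq m) (hq1 m) (hqd m) (hq0 m) hE hf hfm
  obtain ⟨S, hS, rfl⟩ := hE 0
  have hS' : MeasurableSet ((fun μ : Measure X => μ.map (κ 0)) ⁻¹' S) :=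
    Measure.measurable_map _ (hκ 0) hS
  set E := (fun ω => (η ω).map (κ 0)) ⁻¹' S
  have hsq : Pr E = Pr E * Pr E := by
    have := congrArg (fun Q => Q ((fun μ : Measure X => μ.map (κ 0)) ⁻¹' S)) hlaw
    rw [Measure.map_apply h.measurable hS', Measure.restrict_apply (h.measurable hS'),
      Measure.smul_apply, Measure.map_apply h.measurable hS', smul_eq_mul] at this
    rwa [show η ⁻¹' _ = E from rfl, Set.inter_self] at this
  rcases eq_or_ne (Pr E) 0 with hzero | hne
  · exact .inl hzero
  · exact .inr (ENNReal.mul_right_inj hne (measure_ne_top _ _) |>.1 (by rw [← hsq, mul_one]))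

end IsPoissonRandomMeasure

end ZeroOne

/-! ### The Markov chain -/

section Paths

variable {V : Type*}

/-- The path that starts at `x` and then follows `w`. -/
def cons (x : V) (w : ℕ → V) (n : ℕ) : V := Nat.casesOn n x w

@[simp] theorem cons_zero (x : V) (w : ℕ → V) : cons x w 0 = x := rfl

@[simp] theorem cons_succ (x : V) (w : ℕ → V) (n : ℕ) : cons x w (n + 1) = w n := rfl

theorem setOf_cons_eq (x : V) (n : ℕ) (s : ℕ → V) :
    {w | ∀ i ≤ n + 1, cons x w i = s i} = {w | x = s 0 ∧ ∀ i ≤ n, w i = s (i + 1)} := by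
  ext w
  refine ⟨fun h => ⟨h 0 (Nat.zero_le _), fun i hi => h (i + 1) (by omega)⟩, ?_⟩
  rintro ⟨hx, h⟩ (_ | i) hi
  · exact hx
  · exact h i (by omega)

/-- The part of a path after time `n`. -/
def after (n : ℕ) (w : ℕ → V) (k : ℕ) : V := w (n + k)

/-- The time shift of a two-sided sequence. -/
def shift (k : ℤ) (w : ℤ → V) (n : ℤ) : V := w (n + k)

theorem shift_shift (k l : ℤ) (w : ℤ → V) : shift k (shift l w) = shift (k + l) w := by
  funext n
  simp [shift, add_assoc]

theorem shift_zero (w : ℤ → V) : shift 0 w = w := by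
  funext n
  simp [shift]

theorem glue_natCast {u v : ℕ → V} (n : ℕ) : glue (u, v) n = v n := by
  simp [glue]

theorem glue_zero {u v : ℕ → V} : glue (u, v) 0 = v 0 := glue_natCast 0

theorem glue_neg_natCast {u v : ℕ → V} (h : u 0 = v 0) (n : ℕ) : glue (u, v) (-n) = u n := by
  cases n with
  | zero => simpa [glue] using h.symm
  | succ n =>
    unfold glue
    rw [if_neg (by omega)]
    simp

theorem shift_one_glue {x y : V} {u v : ℕ → V} (h : u 0 = x) :
    shift 1 (glue (u, cons x v)) = glue (cons y u, v) := by
  funext n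
  unfold shift glue
  obtain hn | rfl | hn : 0 ≤ n ∨ n = -1 ∨ n < -1 := by omega
  · rw [if_pos (by omega), if_pos hn]
    obtain ⟨k, rfl⟩ := Int.eq_ofNat_of_zero_le hn
    rfl
  · simp [cons, h]
  · rw [if_neg (by omega), if_neg (by omega)]
    obtain ⟨k, hk⟩ := Int.eq_ofNat_of_zero_le (show 0 ≤ -n - 1 by omega)
    simp only [show (-(n + 1)).toNat = k by omega, show (-n).toNat = k + 1 by omega, cons_succ]

theorem hitTime_lt_top_iff {K : Set V} {w : ℕ → V} : hitTime K w < ⊤ ↔ ∃ n, w n ∈ K := by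
  rw [lt_top_iff_ne_top, ne_eq, hitTime_eq_top_iff]
  push Not
  rfl

theorem pairwise_disjoint_lastVisit (K A : Set V) :
    Pairwise (Function.onFun Disjoint fun n : ℕ =>
      {w : ℕ → V | w n ∈ A ∩ K ∧ after n w ∈ {w | returnTime K w = ⊤}}) := by
  refine (pairwise_disjoint_on _).2 fun m n hmn => Set.disjoint_left.2 fun w hm hn => ?_
  have := returnTime_eq_top_iff.1 hm.2 (n - m) (by omega)
  rw [after, Nat.add_sub_cancel' hmn.le] at this
  exact this hn.1.2

variable [MeasurableSpace V]

theorem measurable_cons (x : V) : Measurable (cons x) :=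
  measurable_pi_lambda _ fun n => by
    cases n with
    | zero => exact measurable_const
    | succ n => exact measurable_pi_apply n

theorem measurable_after (n : ℕ) : Measurable (after (V := V) n) :=
  measurable_pi_lambda _ fun _ => measurable_pi_apply _

theorem measurable_shift (k : ℤ) : Measurable (shift (V := V) k) :=
  measurable_pi_lambda _ fun _ => measurable_pi_apply _

theorem measurable_glue : Measurable (glue (V := V)) := by
  refine measurable_pi_lambda _ fun n => ?_
  unfold glue
  split_ifs
  · exact (measurable_pi_apply _).comp measurable_snd
  · exact (measurable_pi_apply _).comp measurable_fst

variable [DiscreteMeasurableSpace V]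

theorem measurableSet_eval_mem {ι : Type*} (i : ι) (A : Set V) :
    MeasurableSet {w : ι → V | w i ∈ A} :=
  (MeasurableSet.of_discrete (s := A)).preimage (measurable_pi_apply i)

theorem measurableSet_eval_eq {ι : Type*} (i : ι) (x : V) : MeasurableSet {w : ι → V | w i = x} :=
  measurableSet_eval_mem i {x}

theorem measurableSet_cylinder (n : ℕ) (s : ℕ → V) :
    MeasurableSet {w : ℕ → V | ∀ i ≤ n, w i = s i} := by
  simp only [Set.ofPred_forall]
  exact MeasurableSet.iInter fun i => MeasurableSet.iInter fun _ => measurableSet_eval_eq _ _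

theorem measurableSet_returnTime (K : Set V) : MeasurableSet {w | returnTime K w = ⊤} := by
  simp only [returnTime_eq_top_iff, Set.ofPred_forall]
  exact MeasurableSet.iInter fun n => MeasurableSet.iInter fun _ =>
    (measurableSet_eval_mem n K).compl

theorem measurableSet_exists_ge_mem (B : Set V) (m : ℕ) :
    MeasurableSet {w : ℕ → V | ∃ k ≥ m, w k ∈ B} := by
  simp only [Set.ofPred_exists]
  refine MeasurableSet.iUnion fun k => ?_
  exact (MeasurableSet.const (k ≥ m)).inter (measurableSet_eval_mem k B)

theorem measurableSet_exists_mem {ι : Type*} [Countable ι] (B : Set V) :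
    MeasurableSet {w : ι → V | ∃ i, w i ∈ B} := by
  simp only [Set.ofPred_exists]
  exact MeasurableSet.iUnion fun i => measurableSet_eval_mem i B

theorem ext_of_cylinder [Countable V] {μ ν : Measure (ℕ → V)}
    [IsFiniteMeasure μ] [IsFiniteMeasure ν]
    (h : ∀ (n : ℕ) (s : ℕ → V), μ {w | ∀ i ≤ n, w i = s i} = ν {w | ∀ i ≤ n, w i = s i}) :
    μ = ν := by
  have map_frestrictLe_eq : ∀ n : ℕ, μ.map (Preorder.frestrictLe (π := fun _ => V) n)
      = ν.map (Preorder.frestrictLe (π := fun _ => V) n) := by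
    intro n
    refine Measure.ext_of_singleton fun z => ?_
    rw [Measure.map_apply (by fun_prop) (measurableSet_singleton z),
      Measure.map_apply (by fun_prop) (measurableSet_singleton z)]
    rcases (Preorder.frestrictLe (π := fun _ => V) n ⁻¹' {z}).eq_empty_or_nonempty with
      hz | ⟨s, rfl⟩
    · simp [hz]
    · convert h n s using 2 <;> ext w <;> simp [funext_iff]
  have isProjectiveLimit : IsProjectiveLimit μ (fun I : Finset ℕ => ν.map I.restrict) := by
    refine (isProjectiveLimit_nat_iff (fun I J hJI => ?_) μ).2 map_frestrictLe_eq
    rw [Measure.map_map (by fun_prop) (by fun_prop)]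
    rfl
  exact isProjectiveLimit.unique fun I => rfl

end Paths

namespace Network

variable {V : Type*} (N : Network V) [MeasurableSpace V] [DiscreteMeasurableSpace V]

theorem P_cylinder_zero [DecidableEq V] (x : V) (s : ℕ → V) :
    N.P x {w | ∀ i ≤ 0, w i = s i} = if x = s 0 then 1 else 0 := by
  have hS : MeasurableSet {z : (i : Finset.Iic 0) → V | z ⟨0, by simp⟩ = s 0} :=
    measurableSet_eval_eq _ _
  have h_preimage : {w : ℕ → V | ∀ i ≤ 0, w i = s i} =
      Preorder.frestrictLe (π := fun _ => V) 0 ⁻¹' {z | z ⟨0, by simp⟩ = s 0} := by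
    ext w; simp
  rw [h_preimage, ← Measure.map_apply (by fun_prop) hS, P, Kernel.traj_map_frestrictLe_apply,
    Kernel.partialTraj_self, Kernel.id_apply, Measure.dirac_apply' _ hS]
  simp [Set.indicator_apply]

omit [MeasurableSpace V] [DiscreteMeasurableSpace V] in
theorem IicProdIoc_preimage_cylinder (n : ℕ) (s : ℕ → V) :
    IicProdIoc (X := fun _ : ℕ => V) n (n + 1) ⁻¹' {z | ∀ i, z i = s i.1}
      = {z : (i : Finset.Iic n) → V | ∀ i, z i = s i.1} ×ˢ
        {z : (i : Finset.Ioc n (n + 1)) → V | z ⟨n + 1, by simp⟩ = s (n + 1)} := by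
  ext ⟨a, b⟩
  simp only [Set.mem_preimage, Set.mem_ofPred_eq, Set.mem_prod, IicProdIoc]
  refine ⟨fun h => ⟨?_, by simpa using h ⟨n + 1, by simp⟩⟩, ?_⟩
  · rintro ⟨i, hi⟩
    have hi' : i ≤ n := by simpa using hi
    simpa [hi'] using h ⟨i, by simp; omega⟩
  · rintro ⟨h_past, h_last⟩ ⟨i, hi⟩
    by_cases hi' : i ≤ n
    · simpa [hi'] using h_past ⟨i, by simpa using hi'⟩
    · obtain rfl : i = n + 1 := by simp at hi; omega
      simpa using h_last

theorem P_cylinder_succ (x : V) (n : ℕ) (s : ℕ → V) :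
    N.P x {w | ∀ i ≤ n + 1, w i = s i}
      = N.P x {w | ∀ i ≤ n, w i = s i} * N.step (s n) {s (n + 1)} := by
  have h_preimage : ∀ n, {w : ℕ → V | ∀ i ≤ n, w i = s i} =
      Preorder.frestrictLe (π := fun _ => V) n ⁻¹' {z | ∀ i, z i = s i.1} := by
    intro n
    ext w
    simp
  have hS : ∀ n, MeasurableSet {z : (i : Finset.Iic n) → V | ∀ i, z i = s i.1} := by
    intro n
    simp only [Set.ofPred_forall]
    exact MeasurableSet.iInter fun i => measurableSet_eval_eq _ _
  have hm : Measurable (IicProdIoc (X := fun _ : ℕ => V) n (n + 1)) := measurable_IicProdIoc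
  have h_last : MeasurableSet
      {z : (i : Finset.Ioc n (n + 1)) → V | z ⟨n + 1, by simp⟩ = s (n + 1)} :=
    measurableSet_eval_eq _ _
  rw [h_preimage, h_preimage, ← Measure.map_apply (by fun_prop) (hS _),
    ← Measure.map_apply (by fun_prop) (hS _), P, Kernel.traj_map_frestrictLe_apply,
    Kernel.traj_map_frestrictLe_apply, Kernel.partialTraj_succ_of_le (Nat.zero_le n),
    Kernel.map_apply' _ hm _ (hS _), Kernel.comp_apply' _ _ _ (hm (hS _)), mul_comm,
    ← lintegral_indicator_const (hS n)]
  refine lintegral_congr fun h => ?_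
  rw [IicProdIoc_preimage_cylinder, Kernel.prod_apply, Measure.prod_prod, Kernel.id_apply,
    Measure.dirac_apply' _ (hS n), Kernel.map_apply' _ (by fun_prop) _ h_last]
  by_cases hh : h ∈ {z : (i : Finset.Iic n) → V | ∀ i, z i = s i.1}
  · simp only [Set.indicator_of_mem hh, Pi.one_apply, one_mul]
    have h_end : h ⟨n, by simp⟩ = s n := hh _
    rw [Kernel.comap_apply, h_end]
    change N.step (s n) _ = _
    congr 1
  · rw [Set.indicator_of_notMem hh, Set.indicator_of_notMem hh, zero_mul]

theorem P_cylinder [DecidableEq V] (x : V) (n : ℕ) (s : ℕ → V) :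
    N.P x {w | ∀ i ≤ n, w i = s i}
      = if x = s 0 then ∏ i ∈ Finset.range n, N.step (s i) {s (i + 1)} else 0 := by
  induction n with
  | zero => simpa using N.P_cylinder_zero x s
  | succ n ih => rw [P_cylinder_succ, ih, ite_mul, zero_mul, Finset.prod_range_succ]

variable [Countable V]

theorem P_eq_bind (x : V) : N.P x = (N.step x).bind fun y => (N.P y).map (cons x) := by
  classical
  have : IsProbabilityMeasure ((N.step x).bind fun y => (N.P y).map (cons x)) := by
    constructor
    rw [Measure.bind_apply MeasurableSet.univ Measurable.of_discrete.aemeasurable]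
    simp [Measure.map_apply (measurable_cons x)]
  refine ext_of_cylinder fun n s => ?_
  rw [Measure.bind_apply (measurableSet_cylinder n s) Measurable.of_discrete.aemeasurable]
  simp_rw [Measure.map_apply (measurable_cons x) (measurableSet_cylinder n s),
    Set.preimage_ofPred_eq]
  cases n with
  | zero =>
    rw [P_cylinder_zero]
    by_cases hx : x = s 0 <;> simp [hx]
  | succ n =>
    simp_rw [setOf_cons_eq]
    by_cases hx : x = s 0
    · have h_start : ∀ y, N.P y {w | ∀ i ≤ n, w i = s (i + 1)} = Set.indicator {s 1}
          (fun _ => ∏ i ∈ Finset.range n, N.step (s (i + 1)) {s (i + 1 + 1)}) y := fun y => by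
        rw [P_cylinder N y n fun i => s (i + 1)]
        simp [Set.indicator_apply]
      simp only [hx, true_and, h_start]
      rw [P_cylinder, if_pos rfl, lintegral_indicator_const (measurableSet_singleton _),
        Finset.prod_range_succ']
    · simp [P_cylinder, hx]

theorem lintegral_P (x : V) {f : (ℕ → V) → ℝ≥0∞} (hf : Measurable f) :
    ∫⁻ w, f w ∂N.P x = ∫⁻ y, ∫⁻ w, f (cons x w) ∂N.P y ∂N.step x := by
  conv_lhs => rw [N.P_eq_bind x]
  rw [Measure.lintegral_bind Measurable.of_discrete.aemeasurable hf.aemeasurable]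
  exact lintegral_congr fun y => lintegral_map hf (measurable_cons x)

theorem P_apply (x : V) {S : Set (ℕ → V)} (hS : MeasurableSet S) :
    N.P x S = ∫⁻ y, N.P y (cons x ⁻¹' S) ∂N.step x := by
  rw [← lintegral_indicator_one hS, N.lintegral_P x (measurable_one.indicator hS)]
  refine lintegral_congr fun y => ?_
  rw [← lintegral_indicator_one (measurable_cons x hS)]
  rfl

theorem P_zero_ae (x : V) : ∀ᵐ w ∂N.P x, w 0 = x := by
  have hS : MeasurableSet {w : ℕ → V | ¬ w 0 = x} := (measurableSet_eval_eq 0 x).compl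
  rw [ae_iff, N.P_apply x hS]
  simp

end Network

/-! ### Reversibility and superharmonic functions -/

namespace Network

variable {V : Type*} (N : Network V)

/-- The total conductance `a_x`, as an extended nonnegative real. -/
def mass (x : V) : ℝ≥0∞ := ENNReal.ofReal (N.total x)

/-- The conductance `a_{x,y}` of an edge, as an extended nonnegative real and extended by `0` to
the pairs of vertices that are not edges. -/
def rate (x y : V) : ℝ≥0∞ :=
  open Classical in if N.graph.Adj x y then ENNReal.ofReal (N.cond x y) else 0

theorem rate_symm (x y : V) : N.rate x y = N.rate y x := by
  unfold rate
  by_cases h : N.graph.Adj x y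
  · rw [if_pos h, if_pos h.symm, N.cond_symm x y h]
  · rw [if_neg h, if_neg fun h' => h h'.symm]

theorem mass_ne_top (x : V) : N.mass x ≠ ∞ := ENNReal.ofReal_ne_top

theorem total_nonneg (x : V) : 0 ≤ N.total x :=
  Finset.sum_nonneg fun z hz => (N.cond_pos x z (by simpa using hz)).le

variable {N} in
theorem total_pos_of_adj {x y : V} (h : N.graph.Adj x y) : 0 < N.total x :=
  Finset.sum_pos (fun z hz => N.cond_pos x z (by simpa using hz)) ⟨y, by simpa using h⟩

variable [MeasurableSpace V]

theorem step_of_total_ne_zero {x : V} (h : N.total x ≠ 0) :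
    N.step x = ∑ y ∈ (N.locallyFinite x).toFinset,
      ENNReal.ofReal (N.p x y) • Measure.dirac y := by
  unfold step
  rw [if_neg h]

variable [DiscreteMeasurableSpace V]

theorem mass_mul_lintegral_step (x : V) (f : V → ℝ≥0∞) :
    N.mass x * ∫⁻ y, f y ∂N.step x = ∑' y, N.rate x y * f y := by
  have rate_of_not_adj : ∀ y, ¬ N.graph.Adj x y → N.rate x y * f y = 0 := fun y hy => by
    rw [rate, if_neg hy, zero_mul]
  by_cases h : N.total x = 0
  · rw [mass, h, ENNReal.ofReal_zero, zero_mul, eq_comm, ENNReal.tsum_eq_zero]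
    exact fun y => rate_of_not_adj y fun hy => (total_pos_of_adj hy).ne' h
  rw [N.step_of_total_ne_zero h, lintegral_finsetSum_measure, Finset.mul_sum,
    tsum_eq_sum (s := (N.locallyFinite x).toFinset)
      fun y hy => rate_of_not_adj y (by simpa using hy)]
  refine Finset.sum_congr rfl fun y hy => ?_
  have hy' : N.graph.Adj x y := by simpa using hy
  rw [lintegral_smul_measure, lintegral_dirac' _ Measurable.of_discrete, smul_eq_mul,
    ← mul_assoc, mass, ← ENNReal.ofReal_mul (N.total_nonneg x), rate, if_pos hy', p, if_pos hy',
    mul_div_cancel₀ _ h]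

theorem ae_step_adj {x : V} (h : N.total x ≠ 0) : ∀ᵐ y ∂N.step x, N.graph.Adj x y := by
  have h0 : N.mass x * ∫⁻ y, {y | ¬ N.graph.Adj x y}.indicator 1 y ∂N.step x = 0 := by
    rw [N.mass_mul_lintegral_step]
    refine ENNReal.tsum_eq_zero.2 fun y => ?_
    by_cases hy : N.graph.Adj x y
    · simp [hy]
    · rw [rate, if_neg hy, zero_mul]
  rw [lintegral_indicator_one MeasurableSet.of_discrete, mul_eq_zero] at h0
  refine h0.resolve_left ?_
  simpa [mass] using lt_of_le_of_ne (N.total_nonneg x) (Ne.symm h)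

/-- The stationary law of the two-sided chain, an infinite measure. -/
def twoSided : Measure (ℤ → V) :=
  Measure.sum fun x => N.mass x • ((N.P x).prod (N.P x)).map glue

theorem lintegral_twoSided {f : (ℤ → V) → ℝ≥0∞} (hf : Measurable f) :
    ∫⁻ w, f w ∂N.twoSided
      = ∑' x, N.mass x * ∫⁻ u, ∫⁻ v, f (glue (u, v)) ∂N.P x ∂N.P x := by
  rw [twoSided, lintegral_sum_measure]
  refine tsum_congr fun x => ?_
  rw [lintegral_smul_measure, smul_eq_mul, lintegral_map hf measurable_glue,
    lintegral_prod (fun q => f (glue q)) (hf.comp measurable_glue).aemeasurable]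

variable {N} in
theorem twoSided_apply_of_ae_iff {A : Set (ℤ → V)} (hA : MeasurableSet A) {K : Finset V}
    {R : Set ((ℕ → V) × (ℕ → V))}
    (h : ∀ y, ∀ᵐ q ∂(N.P y).prod (N.P y), glue q ∈ A ↔ y ∈ K ∧ q ∈ R) :
    N.twoSided A = ∑ y ∈ K, N.mass y * ((N.P y).prod (N.P y)) R := by
  rw [twoSided, Measure.sum_apply _ hA, tsum_eq_sum (s := K)]
  · refine Finset.sum_congr rfl fun y hy => ?_
    rw [Measure.smul_apply, Measure.map_apply measurable_glue hA, smul_eq_mul]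
    congr 1
    refine measure_congr ?_
    filter_upwards [h y] with q hq
    exact propext (hq.trans (and_iff_right hy))
  · intro y hy
    rw [Measure.smul_apply, Measure.map_apply measurable_glue hA, smul_eq_mul]
    refine mul_eq_zero_of_right _ (measure_eq_zero_iff_ae_notMem.2 ?_)
    filter_upwards [h y] with q hq hmem
    exact hy (hq.1 hmem).1

/-- The probability that the chain started at `y` visits `B`. -/
def hitProb (B : Set V) (y : V) : ℝ≥0∞ := N.P y {w | ∃ n, w n ∈ B}

theorem hitProb_le_one (B : Set V) (y : V) : N.hitProb B y ≤ 1 := prob_le_one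

variable [Countable V]

theorem mass_mul_lintegral_P (x : V) {f : (ℕ → V) → ℝ≥0∞} (hf : Measurable f) :
    N.mass x * ∫⁻ w, f w ∂N.P x = ∑' y, N.rate x y * ∫⁻ w, f (cons x w) ∂N.P y := by
  rw [N.lintegral_P x hf, N.mass_mul_lintegral_step]

theorem mass_mul_lintegral_shift_one_glue (x : V) {f : (ℤ → V) → ℝ≥0∞} (hf : Measurable f) :
    N.mass x * ∫⁻ u, ∫⁻ v, f (shift 1 (glue (u, v))) ∂N.P x ∂N.P x
      = ∑' y, N.rate x y * ∫⁻ u, ∫⁻ v, f (glue (cons y u, v)) ∂N.P y ∂N.P x := by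
  have hf_glue : Measurable fun q : (ℕ → V) × (ℕ → V) => f (shift 1 (glue q)) :=
    hf.comp ((measurable_shift 1).comp measurable_glue)
  have hf_cons : ∀ y, Measurable fun u => ∫⁻ v, f (shift 1 (glue (u, cons x v))) ∂N.P y := fun y =>
    Measurable.lintegral_prod_right' (f := fun q : (ℕ → V) × (ℕ → V) =>
      f (shift 1 (glue (q.1, cons x q.2))))
      (hf_glue.comp (measurable_fst.prodMk ((measurable_cons x).comp measurable_snd)))
  have first_step : ∀ u, N.mass x * ∫⁻ v, f (shift 1 (glue (u, v))) ∂N.P x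
      = ∑' y, N.rate x y * ∫⁻ v, f (shift 1 (glue (u, cons x v))) ∂N.P y := fun u =>
    N.mass_mul_lintegral_P x (hf_glue.comp measurable_prodMk_left)
  rw [← lintegral_const_mul _ hf_glue.lintegral_prod_right']
  simp_rw [first_step]
  rw [lintegral_tsum fun y => ((hf_cons y).const_mul _).aemeasurable]
  refine tsum_congr fun y => ?_
  rw [lintegral_const_mul _ (hf_cons y)]
  congr 1
  refine lintegral_congr_ae ?_
  filter_upwards [N.P_zero_ae x] with u hu
  simp_rw [shift_one_glue (y := y) hu]

theorem map_shift_one_twoSided : N.twoSided.map (shift 1) = N.twoSided := by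
  refine Measure.ext_of_lintegral _ fun f hf => ?_
  have first_step_past : ∀ y, N.mass y * ∫⁻ u, ∫⁻ v, f (glue (u, v)) ∂N.P y ∂N.P y
      = ∑' x, N.rate y x * ∫⁻ u, ∫⁻ v, f (glue (cons y u, v)) ∂N.P y ∂N.P x := fun y =>
    N.mass_mul_lintegral_P y (hf.comp measurable_glue).lintegral_prod_right'
  rw [lintegral_map hf (measurable_shift 1), N.lintegral_twoSided hf,
    N.lintegral_twoSided (f := fun w => f (shift 1 w)) (hf.comp (measurable_shift 1))]
  simp_rw [N.mass_mul_lintegral_shift_one_glue _ hf, first_step_past]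
  rw [ENNReal.tsum_comm]
  simp_rw [N.rate_symm]

theorem measurePreserving_shift_natCast (n : ℕ) :
    MeasurePreserving (shift n) N.twoSided N.twoSided := by
  induction n with
  | zero =>
    have shift_natCast_zero : shift (V := V) ((0 : ℕ) : ℤ) = id := funext shift_zero
    rw [shift_natCast_zero]
    exact MeasurePreserving.id _
  | succ n ih =>
    have shift_succ : shift (V := V) ((n + 1 : ℕ) : ℤ) = shift 1 ∘ shift (n : ℤ) := by
      funext w
      rw [Function.comp_apply, shift_shift, add_comm]
      push_cast; rfl
    rw [shift_succ]
    exact MeasurePreserving.comp ⟨measurable_shift 1, N.map_shift_one_twoSided⟩ ih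

theorem measurePreserving_shift (k : ℤ) : MeasurePreserving (shift k) N.twoSided N.twoSided := by
  obtain ⟨n, rfl | rfl⟩ := k.eq_nat_or_neg
  · exact N.measurePreserving_shift_natCast n
  · refine ⟨measurable_shift _, ?_⟩
    have shift_neg_comp : shift (V := V) (-(n : ℤ)) ∘ shift (n : ℤ) = id := by
      funext w
      rw [Function.comp_apply, shift_shift, neg_add_cancel, shift_zero]; rfl
    conv_lhs => rw [← (N.measurePreserving_shift_natCast n).map_eq]
    rw [Measure.map_map (measurable_shift _) (measurable_shift _), shift_neg_comp, Measure.map_id]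

variable {N}

theorem ae_prod_start (y : V) : ∀ᵐ q ∂(N.P y).prod (N.P y), q.1 0 = y ∧ q.2 0 = y :=
  (Measure.quasiMeasurePreserving_fst.ae (N.P_zero_ae y)).and
    (Measure.quasiMeasurePreserving_snd.ae (N.P_zero_ae y))

theorem twoSided_apply_of_prod {A : Set (ℤ → V)} (hA : MeasurableSet A) {S T : Set (ℕ → V)}
    (y : V)
    (h : ∀ u v : ℕ → V, u 0 = v 0 → (glue (u, v) ∈ A ↔ v 0 = y ∧ u ∈ S ∧ v ∈ T)) :
    N.twoSided A = N.mass y * (N.P y S * N.P y T) := by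
  rw [twoSided_apply_of_ae_iff hA (K := {y}) (R := S ×ˢ T), Finset.sum_singleton,
    Measure.prod_prod]
  intro z
  filter_upwards [ae_prod_start z] with q hq
  rw [Finset.mem_singleton, h q.1 q.2 (hq.1.trans hq.2.symm), hq.2, Set.mem_prod]

-- Both sides are the `twoSided`-measure of the paths at `x` at time `-n`, at `y` at time `0` and in
-- `F` from then on: stationarity moves the origin of time from `-n` to `0`.
theorem mass_mul_P_after (x y : V) (n : ℕ) {F : Set (ℕ → V)} (hF : MeasurableSet F) :
    N.mass x * N.P x {w | w n = y ∧ after n w ∈ F}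
      = N.mass y * (N.P y {w | w n = x} * N.P y F) := by
  have measurable_future : Measurable fun (w : ℤ → V) (k : ℕ) => w k :=
    measurable_pi_lambda _ fun _ => measurable_pi_apply _
  have hA : MeasurableSet {w : ℤ → V | w (-n) = x ∧ w 0 = y ∧ (fun k : ℕ => w k) ∈ F} :=
    (measurableSet_eval_eq _ x).inter ((measurableSet_eval_eq _ y).inter (measurable_future hF))
  rw [← twoSided_apply_of_prod hA y (S := {w | w n = x}) (T := F),
    ← (N.measurePreserving_shift n).measure_preimage hA.nullMeasurableSet,
    twoSided_apply_of_prod (measurable_shift _ hA) x (S := Set.univ)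
      (T := {w | w n = y ∧ after n w ∈ F}), measure_univ, one_mul]
  · intro u v _
    have future_eq : (fun k : ℕ => glue (u, v) (k + n)) = after n v := by
      funext k
      rw [after, ← glue_natCast (u := u) (v := v)]
      push_cast
      rw [add_comm]
    simp only [Set.mem_preimage, Set.mem_ofPred_eq, shift, neg_add_cancel, glue_zero, zero_add,
      glue_natCast, Set.mem_univ, true_and]
    rw [future_eq]
  · intro u v huv
    simp only [Set.mem_ofPred_eq, glue_neg_natCast huv, glue_zero, glue_natCast]
    tauto

theorem P_after {x : V} (hx : N.mass x ≠ 0) (y : V) (n : ℕ) {F : Set (ℕ → V)}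
    (hF : MeasurableSet F) :
    N.P x {w | w n = y ∧ after n w ∈ F} = N.P x {w | w n = y} * N.P y F := by
  have after_F := N.mass_mul_P_after x y n hF
  have after_univ := N.mass_mul_P_after x y n MeasurableSet.univ
  simp only [Set.mem_univ, and_true, measure_univ, mul_one] at after_univ
  rw [← mul_assoc, ← after_univ, mul_assoc] at after_F
  exact (ENNReal.mul_right_inj hx (N.mass_ne_top x)).1 after_F

theorem ae_adj (hN : ∀ x, N.total x ≠ 0) (x : V) :
    ∀ᵐ w ∂N.P x, ∀ n, N.graph.Adj (w n) (w (n + 1)) := by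
  rw [ae_all_iff]
  intro n
  have hS : ∀ n, MeasurableSet {w : ℕ → V | ¬ N.graph.Adj (w n) (w (n + 1))} := fun n =>
    (MeasurableSet.of_discrete (s := {a : V × V | ¬ N.graph.Adj a.1 a.2})).preimage
      (f := fun w : ℕ → V => (w n, w (n + 1))) (by fun_prop)
  induction n generalizing x with
  | zero =>
    rw [ae_iff, N.P_apply x (hS 0), lintegral_eq_zero_iff Measurable.of_discrete]
    filter_upwards [N.ae_step_adj (hN x)] with y hy
    change N.P y _ = 0
    rw [measure_eq_zero_iff_ae_notMem]
    filter_upwards [N.P_zero_ae y] with w hw hmem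
    exact hmem (by simpa [hw] using hy)
  | succ n ih =>
    rw [ae_iff, N.P_apply x (hS _), lintegral_eq_zero_iff Measurable.of_discrete]
    filter_upwards with y
    exact ae_iff.1 (ih y)

theorem IsTransient.total_ne_zero (hN : N.IsTransient) (x : V) : N.total x ≠ 0 := by
  intro h
  have hS : MeasurableSet {w : ℕ → V | w 1 ≠ x} := (measurableSet_eval_eq 1 x).compl
  refine (hN x).ne' (measure_mono_null (t := {w | w 1 ≠ x}) ?_ ?_)
  · intro w hw
    exact returnTime_eq_top_iff.1 hw 1 le_rfl
  · rw [N.P_apply x hS, step, if_pos h, lintegral_dirac' _ Measurable.of_discrete]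
    exact ae_iff.1 (N.P_zero_ae x)

theorem IsTransient.mass_ne_zero (hN : N.IsTransient) (x : V) : N.mass x ≠ 0 := by
  simpa [mass] using lt_of_le_of_ne (N.total_nonneg x) (hN.total_ne_zero x).symm

theorem IsTransient.tsum_P_eval_ne_top (hN : N.IsTransient) (x y : V) :
    ∑' n, N.P x {w | w n = y} ≠ ∞ := by
  have hF := measurableSet_returnTime ({y} : Set V)
  have last_visit_le : (∑' n, N.P x {w | w n = y}) * N.P y {w | returnTime {y} w = ⊤} ≤ 1 := by
    have h_disjoint := pairwise_disjoint_lastVisit ({y} : Set V) {y}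
    simp only [Set.inter_self, Set.mem_singleton_iff] at h_disjoint
    rw [← ENNReal.tsum_mul_right]
    simp_rw [← P_after (hN.mass_ne_zero x) y _ hF]
    rw [← measure_iUnion h_disjoint fun n =>
      (measurableSet_eval_eq n y).inter (measurable_after n hF)]
    exact prob_le_one
  intro htop
  rw [htop, ENNReal.top_mul (hN y).ne'] at last_visit_le
  exact absurd last_visit_le (by simp)

theorem IsTransient.ae_finite_visits (hN : N.IsTransient) (x : V) :
    ∀ᵐ w ∂N.P x, ∀ y, {n | w n = y}.Finite :=
  ae_all_iff.2 fun y => ae_finite_setOfPred_mem (hN.tsum_P_eval_ne_top x y)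

variable (N)

theorem lintegral_hitProb_step_le (B : Set V) (y : V) :
    ∫⁻ z, N.hitProb B z ∂N.step y ≤ N.hitProb B y := by
  rw [hitProb, N.P_apply y (measurableSet_exists_mem B)]
  refine lintegral_mono fun z => measure_mono ?_
  rintro w ⟨n, hn⟩
  exact ⟨n + 1, hn⟩

theorem mul_P_exists_le_of_superharmonic {h : V → ℝ≥0∞} (hh : ∀ y, ∫⁻ z, h z ∂N.step y ≤ h y)
    (ε : ℝ≥0∞) (m : ℕ) (y : V) : ε * N.P y {w | ∃ k ≤ m, w k ∈ {z | ε < h z}} ≤ h y := by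
  induction m generalizing y with
  | zero =>
    by_cases hy : ε < h y
    · exact (mul_le_of_le_one_right' prob_le_one).trans hy.le
    · rw [measure_eq_zero_iff_ae_notMem.2, mul_zero]
      · exact zero_le
      · filter_upwards [N.P_zero_ae y] with w hw
        simp [hw, not_lt.1 hy]
  | succ m ih =>
    by_cases hy : ε < h y
    · exact (mul_le_of_le_one_right' prob_le_one).trans hy.le
    have hS : MeasurableSet {w : ℕ → V | ∃ k ≤ m + 1, w k ∈ {z | ε < h z}} := by
      simp only [Set.ofPred_exists]
      refine MeasurableSet.iUnion fun k => ?_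
      exact (MeasurableSet.const (k ≤ m + 1)).inter (measurableSet_eval_mem k {z | ε < h z})
    rw [N.P_apply y hS, ← lintegral_const_mul _ Measurable.of_discrete]
    refine le_trans (lintegral_mono fun z => ?_) (hh y)
    refine le_trans (mul_le_mul_right (measure_mono ?_) _) (ih z)
    rintro w ⟨_ | k, hk, hmem⟩
    · exact absurd hmem hy
    · exact ⟨k, by omega, hmem⟩

theorem mul_hitProb_le_of_superharmonic {h : V → ℝ≥0∞} (hh : ∀ y, ∫⁻ z, h z ∂N.step y ≤ h y)
    (ε : ℝ≥0∞) (y : V) : ε * N.hitProb {z | ε < h z} y ≤ h y := by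
  have h_iUnion : {w : ℕ → V | ∃ k, w k ∈ {z | ε < h z}}
      = ⋃ m : ℕ, {w | ∃ k ≤ m, w k ∈ {z | ε < h z}} := by
    ext w
    simp only [Set.mem_ofPred_eq, Set.mem_iUnion]
    exact ⟨fun ⟨k, hk⟩ => ⟨k, k, le_rfl, hk⟩, fun ⟨_, k, _, hk⟩ => ⟨k, hk⟩⟩
  rw [hitProb, h_iUnion, Monotone.measure_iUnion, ENNReal.mul_iSup]
  · exact iSup_le fun m => N.mul_P_exists_le_of_superharmonic hh ε m y
  · rintro m n hmn w ⟨k, hk, h⟩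
    exact ⟨k, hk.trans hmn, h⟩

omit [MeasurableSpace V] [DiscreteMeasurableSpace V] [Countable V] in
theorem cons_preimage_exists_ge (y : V) (m : ℕ) (A : Set V) :
    cons y ⁻¹' {w | ∃ k ≥ m + 1, w k ∈ A} = {w | ∃ k ≥ m, w k ∈ A} := by
  ext w
  refine ⟨?_, fun ⟨k, hk, h⟩ => ⟨k + 1, by omega, h⟩⟩
  rintro ⟨_ | k, hk, h⟩
  · omega
  · exact ⟨k, by omega, h⟩

theorem mul_P_exists_ge_le (B : Set V) (ε : ℝ≥0∞) (m : ℕ) (y : V) :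
    ε * N.P y {w | ∃ k ≥ m, w k ∈ {z | ε < N.hitProb B z}} ≤ N.P y {w | ∃ k ≥ m, w k ∈ B} := by
  induction m generalizing y with
  | zero =>
    simpa [hitProb] using
      N.mul_hitProb_le_of_superharmonic (N.lintegral_hitProb_step_le B) ε y
  | succ m ih =>
    rw [N.P_apply y (measurableSet_exists_ge_mem _ _),
      N.P_apply y (measurableSet_exists_ge_mem _ _), ← lintegral_const_mul _ Measurable.of_discrete]
    simp_rw [cons_preimage_exists_ge]
    exact lintegral_mono fun z => ih z

end Network

/-! ### Equilibrium measures of exhaustions -/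

namespace Network

variable {V : Type*} {N : Network V} [MeasurableSpace V] [DiscreteMeasurableSpace V]

theorem lintegral_eqMeasure (L : Finset V) (f : V → ℝ≥0∞) :
    ∫⁻ y, f y ∂N.eqMeasure L = ∑ y ∈ L, N.eqMass L y * f y := by
  simp [eqMeasure, lintegral_finsetSum_measure, lintegral_dirac' _ Measurable.of_discrete]

theorem hitProb_singleton_le_tsum (x y : V) :
    N.hitProb {x} y ≤ ∑' n, N.P y {w | w n = x} := by
  refine le_trans (measure_mono ?_) (measure_iUnion_le fun n => {w : ℕ → V | w n = x})
  rintro w ⟨n, hn⟩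
  exact Set.mem_iUnion.2 ⟨n, hn⟩

theorem hitProb_insert_le (x : V) (B : Set V) (y : V) :
    N.hitProb (insert x B) y ≤ N.hitProb {x} y + N.hitProb B y := by
  refine le_trans (measure_mono ?_) (measure_union_le _ _)
  rintro w ⟨n, hn | hn⟩
  · exact Or.inl ⟨n, hn⟩
  · exact Or.inr ⟨n, hn⟩

theorem P_eval_mem_inter_finset (x : V) (n : ℕ) (A : Set V) (L : Finset V) {F : Set (ℕ → V)}
    (hF : MeasurableSet F) :
    N.P x {w | w n ∈ A ∩ L ∧ after n w ∈ F}
      = ∑ y ∈ L, A.indicator (fun y => N.P x {w | w n = y ∧ after n w ∈ F}) y := by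
  classical
  have h_biUnion : {w : ℕ → V | w n ∈ A ∩ L ∧ after n w ∈ F}
      = ⋃ y ∈ L.filter (· ∈ A), {w | w n = y ∧ after n w ∈ F} := by
    ext w
    simp [and_comm, and_assoc]
  have hm : ∀ y, MeasurableSet {w : ℕ → V | w n = y ∧ after n w ∈ F} := fun y =>
    (measurableSet_eval_eq n y).inter (measurable_after n hF)
  rw [h_biUnion, measure_biUnion_finset ?_ fun y _ => hm y, Finset.sum_filter]
  · rfl
  · exact fun y _ z _ hyz => Set.disjoint_left.2 fun w h h' => hyz (h.1.symm.trans h'.1)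

theorem tendsto_P_eval_notMem {L : ℕ → Finset V} (hL : IsExhaustion L) (x : V) (m : ℕ) :
    Tendsto (fun n => N.P x {w | w m ∉ L n}) atTop (𝓝 0) := by
  have h : Tendsto (fun n => N.P x {w | w m ∉ L n}) atTop (𝓝 (N.P x (⋂ n, {w | w m ∉ L n}))) := by
    refine tendsto_measure_iInter_atTop (fun n => ?_) ?_ ⟨0, measure_ne_top _ _⟩
    · exact (measurableSet_eval_mem m (L n : Set V)).compl.nullMeasurableSet
    · exact fun a b hab w hw hmem => hw (hL.mono hab hmem)
  have h_iInter : (⋂ n, {w : ℕ → V | w m ∉ L n}) = ∅ := by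
    ext w
    simpa using hL.cover (w m)
  rwa [h_iInter, measure_empty] at h

variable [Countable V]

theorem eqMass_mul_hitProb_le (x y : V) (L : Finset V) :
    N.eqMass L y * N.hitProb {x} y
      ≤ ∑' n, N.mass x * N.P x {w | w n = y ∧ after n w ∈ {w | returnTime (L : Set V) w = ⊤}} := by
  by_cases hy : y ∈ L
  · simp_rw [mass_mul_P_after x y _ (measurableSet_returnTime (L : Set V))]
    rw [ENNReal.tsum_mul_left, ENNReal.tsum_mul_right, eqMass, if_pos hy, mul_right_comm, mul_assoc,
      mass]
    gcongr
    exact hitProb_singleton_le_tsum x y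
  · rw [eqMass, if_neg hy, zero_mul]
    exact zero_le

-- Decompose the chain from `x` at its last visit to `L`: by reversibility, the mass of the paths
-- whose last visit takes place at `y` is `e_L(y)` times the Green function, which is at least
-- `P_y[τ_x < ∞]`.
theorem setLIntegral_hitProb_eqMeasure_le (x : V) (L : Finset V) (A : Set V) :
    ∫⁻ y in A, N.hitProb {x} y ∂N.eqMeasure L
      ≤ N.mass x *
        N.P x {w | ∃ n, w n ∈ A ∩ L ∧ after n w ∈ {w | returnTime (L : Set V) w = ⊤}} := by
  set F := {w : ℕ → V | returnTime (L : Set V) w = ⊤}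
  have hF : MeasurableSet F := measurableSet_returnTime _
  have h_iUnion : {w : ℕ → V | ∃ n, w n ∈ A ∩ L ∧ after n w ∈ F}
      = ⋃ n, {w | w n ∈ A ∩ L ∧ after n w ∈ F} := Set.ofPred_exists _
  have h_disjoint : Pairwise (Function.onFun Disjoint fun n : ℕ =>
      {w : ℕ → V | w n ∈ A ∩ L ∧ after n w ∈ F}) := pairwise_disjoint_lastVisit _ _
  rw [← lintegral_indicator MeasurableSet.of_discrete, lintegral_eqMeasure, h_iUnion,
    measure_iUnion h_disjoint fun n =>
      (measurableSet_eval_mem n (A ∩ L)).inter (measurable_after n hF), ← ENNReal.tsum_mul_left]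
  simp_rw [P_eval_mem_inter_finset x _ A L hF, Finset.mul_sum]
  rw [Summable.tsum_finsetSum fun _ _ => ENNReal.summable]
  refine Finset.sum_le_sum fun y _ => ?_
  by_cases hy : y ∈ A
  · simpa only [Set.indicator_of_mem hy] using eqMass_mul_hitProb_le x y L
  · simp [Set.indicator_of_notMem hy]

theorem lintegral_hitProb_eqMeasure_le (x : V) (L : Finset V) :
    ∫⁻ y, N.hitProb {x} y ∂N.eqMeasure L ≤ N.mass x := by
  rw [← setLIntegral_univ]
  exact (setLIntegral_hitProb_eqMeasure_le x L Set.univ).trans (mul_le_of_le_one_right' prob_le_one)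

variable (N) in
theorem P_exists_ge_le_inv_mul (x : V) {ε : ℝ≥0∞} (hε : ε ≠ 0) (hε' : ε ≠ ∞) (B : Set V) (m : ℕ) :
    N.P x {w | ∃ k ≥ m, w k ∈ {z | ε < N.hitProb B z}}
      ≤ ε⁻¹ * N.P x {w | ∃ k ≥ m, w k ∈ B} := by
  rw [← ENNReal.div_eq_inv_mul, ENNReal.le_div_iff_mul_le (Or.inl hε) (Or.inl hε'), mul_comm]
  exact N.mul_P_exists_ge_le B ε m x

-- The last visit to `L` takes place either after time `m`, or before, and then `w m ∉ L`.
theorem setLIntegral_hitProb_eqMeasure_le_add (x : V) {ε : ℝ≥0∞} (hε : ε ≠ 0) (hε' : ε ≠ ∞)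
    (L : Finset V) (m : ℕ) :
    ∫⁻ y in {z | ε < N.hitProb {x} z}, N.hitProb {x} y ∂N.eqMeasure L
      ≤ N.mass x * (ε⁻¹ * N.P x {w | ∃ k ≥ m, w k ∈ ({x} : Set V)})
        + N.mass x * N.P x {w | w m ∉ L} := by
  refine (setLIntegral_hitProb_eqMeasure_le x L _).trans ?_
  rw [← mul_add]
  gcongr
  refine le_trans (measure_mono ?_) ((measure_union_le _ _).trans
    (add_le_add (N.P_exists_ge_le_inv_mul x hε hε' {x} m) le_rfl))
  rintro w ⟨k, hk, h_last⟩
  by_cases hkm : m ≤ k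
  · exact Or.inl ⟨k, hkm, hk.1⟩
  · have := returnTime_eq_top_iff.1 h_last (m - k) (by omega)
    rw [after, Nat.add_sub_cancel' (by omega)] at this
    exact Or.inr this

theorem IsTransient.tendsto_P_exists_ge (hN : N.IsTransient) (x : V) :
    Tendsto (fun m => N.P x {w | ∃ k ≥ m, w k ∈ ({x} : Set V)}) atTop (𝓝 0) := by
  refine tendsto_of_tendsto_of_tendsto_of_le_of_le tendsto_const_nhds
    (ENNReal.tendsto_sum_nat_add _ (hN.tsum_P_eval_ne_top x x)) (fun _ => zero_le) fun m => ?_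
  refine le_trans (measure_mono ?_) (measure_iUnion_le fun k => {w : ℕ → V | w (k + m) = x})
  rintro w ⟨k, hk, h⟩
  rw [← Nat.sub_add_cancel hk] at h
  exact Set.mem_iUnion.2 ⟨k - m, h⟩

theorem IsTransient.tendsto_setLIntegral_hitProb (hN : N.IsTransient) (x : V) {ε : ℝ≥0∞}
    (hε : ε ≠ 0) {L : ℕ → Finset V} (hL : IsExhaustion L) :
    Tendsto (fun n => ∫⁻ y in {z | ε < N.hitProb {x} z}, N.hitProb {x} y ∂N.eqMeasure (L n))
      atTop (𝓝 0) := by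
  by_cases hε' : ε = ∞
  · simp [hε']
  have late_visits : Tendsto
      (fun m => N.mass x * (ε⁻¹ * N.P x {w | ∃ k ≥ m, w k ∈ ({x} : Set V)})) atTop (𝓝 0) := by
    simpa using ENNReal.Tendsto.const_mul (a := N.mass x) (ENNReal.Tendsto.const_mul (a := ε⁻¹)
      (hN.tendsto_P_exists_ge x) (Or.inr (ENNReal.inv_ne_top.2 hε))) (Or.inr (N.mass_ne_top x))
  have early_exit : ∀ m, Tendsto (fun n => N.mass x * N.P x {w | w m ∉ L n}) atTop (𝓝 0) := by
    intro m
    simpa using ENNReal.Tendsto.const_mul (a := N.mass x) (tendsto_P_eval_notMem hL x m)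
      (Or.inr (N.mass_ne_top x))
  rw [ENNReal.tendsto_nhds_zero]
  intro δ hδ
  have hδ2 : 0 < δ / 2 := ENNReal.half_pos hδ.ne'
  obtain ⟨m, hm⟩ := (ENNReal.tendsto_nhds_zero.1 late_visits (δ / 2) hδ2).exists
  filter_upwards [ENNReal.tendsto_nhds_zero.1 (early_exit m) (δ / 2) hδ2] with n hn
  exact (setLIntegral_hitProb_eqMeasure_le_add x hε hε' (L n) m).trans
    ((add_le_add hm hn).trans_eq (ENNReal.add_halves δ))

theorem IsTransient.tendsto_eqMeasure (hN : N.IsTransient) (x : V) {ε : ℝ≥0∞} (hε : ε ≠ 0)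
    {L : ℕ → Finset V} (hL : IsExhaustion L) :
    Tendsto (fun n => N.eqMeasure (L n) {z | ε < N.hitProb {x} z}) atTop (𝓝 0) := by
  by_cases hε' : ε = ∞
  · simp [hε']
  have h := ENNReal.Tendsto.const_mul (a := ε⁻¹) (hN.tendsto_setLIntegral_hitProb x hε hL)
    (Or.inr (ENNReal.inv_ne_top.2 hε))
  rw [mul_zero] at h
  refine tendsto_of_tendsto_of_tendsto_of_le_of_le tendsto_const_nhds h (fun _ => zero_le)
    fun n => ?_
  dsimp only
  rw [← ENNReal.div_eq_inv_mul, ENNReal.le_div_iff_mul_le (Or.inl hε) (Or.inl hε'), mul_comm,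
    ← setLIntegral_const]
  exact setLIntegral_mono Measurable.of_discrete fun y hy => hy.le

theorem IsTransient.tendsto_lintegral_hitProb_singleton_sq (hN : N.IsTransient) (x : V)
    {L : ℕ → Finset V} (hL : IsExhaustion L) :
    Tendsto (fun n => ∫⁻ y, N.hitProb {x} y ^ 2 ∂N.eqMeasure (L n)) atTop (𝓝 0) := by
  rw [ENNReal.tendsto_nhds_zero]
  intro δ hδ
  have hδ2 : 0 < δ / 2 := ENNReal.half_pos hδ.ne'
  set ε := δ / 2 / N.mass x
  have hε : ε ≠ 0 := (ENNReal.div_pos hδ2.ne' (N.mass_ne_top x)).ne'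
  set A := {z | ε < N.hitProb {x} z}
  have sq_le : ∀ y, N.hitProb {x} y ^ 2
      ≤ ε * N.hitProb {x} y + A.indicator (fun y => N.hitProb {x} y) y := by
    intro y
    rw [sq]
    by_cases hy : y ∈ A
    · rw [Set.indicator_of_mem hy]
      exact (mul_le_of_le_one_right' (N.hitProb_le_one {x} y)).trans le_add_self
    · exact (mul_le_mul_left (not_lt.1 hy) _).trans le_self_add
  filter_upwards [ENNReal.tendsto_nhds_zero.1 (hN.tendsto_setLIntegral_hitProb x hε hL) _ hδ2]
    with n hn
  calc ∫⁻ y, N.hitProb {x} y ^ 2 ∂N.eqMeasure (L n)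
      ≤ ε * ∫⁻ y, N.hitProb {x} y ∂N.eqMeasure (L n)
          + ∫⁻ y in A, N.hitProb {x} y ∂N.eqMeasure (L n) := by
        rw [← lintegral_const_mul _ Measurable.of_discrete,
          ← lintegral_indicator MeasurableSet.of_discrete,
          ← lintegral_add_left Measurable.of_discrete]
        exact lintegral_mono sq_le
    _ ≤ ε * N.mass x + δ / 2 := by
        gcongr
        exact lintegral_hitProb_eqMeasure_le x (L n)
    _ = δ := by
        rw [ENNReal.div_mul_cancel (hN.mass_ne_zero x) (N.mass_ne_top x), ENNReal.add_halves]

theorem IsTransient.tendsto_lintegral_hitProb_sq (hN : N.IsTransient) (B : Finset V)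
    {L : ℕ → Finset V} (hL : IsExhaustion L) :
    Tendsto (fun n => ∫⁻ y, N.hitProb B y ^ 2 ∂N.eqMeasure (L n)) atTop (𝓝 0) := by
  classical
  induction B using Finset.induction_on with
  | empty => simp [hitProb]
  | insert x B _ ih =>
    have h := ENNReal.Tendsto.const_mul (a := 2)
      ((hN.tendsto_lintegral_hitProb_singleton_sq x hL).add ih) (Or.inr (by simp))
    rw [add_zero, mul_zero] at h
    refine tendsto_of_tendsto_of_tendsto_of_le_of_le tendsto_const_nhds h (fun _ => zero_le)
      fun n => ?_
    dsimp only
    rw [← lintegral_add_left Measurable.of_discrete, ← lintegral_const_mul _ Measurable.of_discrete]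
    refine lintegral_mono fun y => ?_
    have sq_add_le : (N.hitProb {x} y + N.hitProb B y) ^ 2
        ≤ 2 * (N.hitProb {x} y ^ 2 + N.hitProb B y ^ 2) := by
      have := ENNReal.rpow_add_le_mul_rpow_add_rpow (N.hitProb {x} y) (N.hitProb B y) one_le_two
      norm_num at this
      exact_mod_cast this
    refine le_trans ?_ sq_add_le
    rw [Finset.coe_insert]
    gcongr
    exact hitProb_insert_le x B y

end Network

/-! ### The spaces of trajectories -/

section Trajectories

variable {V : Type*} {G : SimpleGraph V}

theorem mk_mem_hitSet {K : Finset V} {w : Traj G} :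
    (⟦w⟧ : TrajMod G) ∈ hitSet G K ↔ w.Hits K := by
  refine ⟨?_, fun h => ⟨w, h, rfl⟩⟩
  rintro ⟨w', hw', h⟩
  exact (Traj.Hits.congr (Quotient.exact h)).1 hw'

theorem hitSet_mono {K K' : Finset V} (h : K ⊆ K') : hitSet G K ⊆ hitSet G K' := by
  rintro _ ⟨w, ⟨n, hn⟩, rfl⟩
  exact ⟨w, ⟨n, h hn⟩, rfl⟩

theorem iUnion_hitSet {K : ℕ → Finset V} (hK : IsExhaustion K) :
    ⋃ n, hitSet G (K n) = Set.univ := by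
  refine Set.eq_univ_of_forall fun z => ?_
  induction z using Quotient.inductionOn with
  | h w =>
    obtain ⟨n, hn⟩ := hK.cover (w.1 0)
    exact Set.mem_iUnion.2 ⟨n, mk_mem_hitSet.2 ⟨0, hn⟩⟩

theorem hitSet_diff_eq_disjointed {K : ℕ → Finset V} (hK : IsExhaustion K) (n : ℕ) :
    hitSet G (K (n + 1)) \ hitSet G (K n) = disjointed (fun n => hitSet G (K n)) (n + 1) :=
  (Monotone.disjointed_add_one (fun _ _ h => hitSet_mono (hK.mono h)) n).symm

theorem pairwise_disjoint_hitSet_diff {K : ℕ → Finset V} (hK : IsExhaustion K) :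
    Pairwise (Function.onFun Disjoint fun n => hitSet G (K (n + 1)) \ hitSet G (K n)) := by
  simp only [hitSet_diff_eq_disjointed hK]
  exact (disjoint_disjointed _).comp_of_injective (add_left_injective 1)

theorem iUnion_hitSet_diff {K : ℕ → Finset V} (hK : IsExhaustion K) (hK0 : K 0 = ∅) :
    ⋃ n, hitSet G (K (n + 1)) \ hitSet G (K n) = Set.univ := by
  have hitSet_zero : disjointed (fun n => hitSet G (K n)) 0 = ∅ := by
    rw [disjointed_zero, hK0]
    exact Set.eq_empty_of_forall_notMem fun z ⟨w, ⟨n, hn⟩, _⟩ => Finset.notMem_empty _ hn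
  simp only [hitSet_diff_eq_disjointed hK]
  rw [← Set.empty_union (⋃ n, _), ← hitSet_zero, Set.union_iUnion_nat_succ, iUnion_disjointed,
    iUnion_hitSet hK]

theorem lam_eq_iff {K : Finset V} {w : Traj G} (h : w.Hits K) (k : ℤ) :
    w.lam K = k ↔ w.1 k ∈ K ∧ ∀ n > k, w.1 n ∉ K := by
  have bddAbove : BddAbove {n | w.1 n ∈ K} := (visits_finite K w).bddAbove
  have nonempty : {n | w.1 n ∈ K}.Nonempty := h
  constructor
  · rintro rfl
    exact ⟨Int.csSup_mem nonempty bddAbove,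
      fun n hn hmem => absurd (le_csSup bddAbove hmem) (not_le.2 hn)⟩
  · rintro ⟨hk, hgt⟩
    exact IsGreatest.csSup_eq ⟨hk, fun n hn => not_lt.1 fun hlt => hgt n hlt hn⟩

theorem lam_of_not_hits {K : Finset V} {w : Traj G} (h : ¬ w.Hits K) : w.lam K = 0 := by
  have visits_eq_empty : {n | w.1 n ∈ K} = ∅ :=
    Set.eq_empty_of_forall_notMem fun n hn => h ⟨n, hn⟩
  rw [Traj.lam, visits_eq_empty, Int.csSup_empty]

theorem keepFuture_of_hits {K : Finset V} {w : Traj G} (h : w.Hits K) :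
    keepFuture K ⟦w⟧ = Sum.inl (w.future K) := if_pos h

theorem keepFuture_of_not_hits {K : Finset V} {w : Traj G} (h : ¬ w.Hits K) :
    keepFuture K ⟦w⟧ = Sum.inr ⟦w⟧ := if_neg h

theorem preimage_keepFuture_range_inl (K : Finset V) :
    keepFuture K ⁻¹' Set.range Sum.inl = hitSet G K := by
  ext z
  induction z using Quotient.inductionOn with
  | h w =>
    rw [Set.mem_preimage, mk_mem_hitSet]
    by_cases h : w.Hits K
    · simp [keepFuture_of_hits h, h]
    · simp [keepFuture_of_not_hits h, h]

theorem isTraj_glue {u v : ℕ → V} (huv : u 0 = v 0)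
    (hu : (∀ n, G.Adj (u n) (u (n + 1))) ∧ ∀ x, {n | u n = x}.Finite)
    (hv : (∀ n, G.Adj (v n) (v (n + 1))) ∧ ∀ x, {n | v n = x}.Finite) :
    (∀ n, G.Adj (glue (u, v) n) (glue (u, v) (n + 1))) ∧ ∀ x, {n | glue (u, v) n = x}.Finite := by
  refine ⟨fun n => ?_, fun x => ?_⟩
  · obtain ⟨k, rfl⟩ | ⟨k, rfl⟩ : (∃ k : ℕ, n = k) ∨ ∃ k : ℕ, n = -((k + 1 : ℕ) : ℤ) := by
      rcases le_or_gt 0 n with hn | hn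
      · exact Or.inl ⟨n.toNat, by omega⟩
      · exact Or.inr ⟨(-n).toNat - 1, by omega⟩
    · rw [← Nat.cast_succ, glue_natCast, glue_natCast]
      exact hv.1 k
    · rw [show -((k + 1 : ℕ) : ℤ) + 1 = -(k : ℤ) by push_cast; ring, glue_neg_natCast huv,
        glue_neg_natCast huv]
      exact (hu.1 k).symm
  · refine (((hu.2 x).image fun n : ℕ => -(n : ℤ)).union
      ((hv.2 x).image fun n : ℕ => (n : ℤ))).subset fun n hn => ?_
    obtain ⟨k, rfl | rfl⟩ := n.eq_nat_or_neg
    · exact Or.inr ⟨k, (glue_natCast k).symm.trans hn, rfl⟩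
    · exact Or.inl ⟨k, (glue_neg_natCast huv k).symm.trans hn, rfl⟩

variable [MeasurableSpace V]

theorem measurable_mk : Measurable (Quotient.mk (shiftSetoid G)) := measurable_quotient_mk'

variable [DiscreteMeasurableSpace V]

theorem measurableSet_finite_visits {ι : Type*} [Countable ι] (x : V) :
    MeasurableSet {w : ι → V | {n | w n = x}.Finite} := by
  have finite_iff : ∀ w : ι → V, {n | w n = x}.Finite ↔ ∃ s : Finset ι, ∀ n ∉ s, w n ≠ x := by
    refine fun w => ⟨fun h => ⟨h.toFinset, fun n hn => by simpa using hn⟩, ?_⟩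
    rintro ⟨s, hs⟩
    exact s.finite_toSet.subset fun n hn => by_contra fun hns => hs n hns hn
  simp only [finite_iff, Set.ofPred_exists, Set.ofPred_forall]
  exact MeasurableSet.iUnion fun s => MeasurableSet.iInter fun n => MeasurableSet.iInter fun _ =>
    (measurableSet_eval_eq n x).compl

variable [Countable V]

theorem measurableSet_isTraj {ι : Type*} [Countable ι] [Add ι] [One ι] (G : SimpleGraph V) :
    MeasurableSet {w : ι → V | (∀ n, G.Adj (w n) (w (n + 1))) ∧ ∀ x, {n | w n = x}.Finite} := by
  simp only [Set.ofPred_and, Set.ofPred_forall]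
  have measurableSet_adj : ∀ n, MeasurableSet {w : ι → V | G.Adj (w n) (w (n + 1))} := fun n =>
    (MeasurableSet.of_discrete (s := {a : V × V | G.Adj a.1 a.2})).preimage
      (f := fun w : ι → V => (w n, w (n + 1))) (by fun_prop)
  exact (MeasurableSet.iInter measurableSet_adj).inter
    (MeasurableSet.iInter fun x => measurableSet_finite_visits x)

theorem measurableEmbedding_traj_val (G : SimpleGraph V) :
    MeasurableEmbedding fun w : Traj G => w.1 :=
  MeasurableEmbedding.subtype_coe (measurableSet_isTraj G)

theorem measurableEmbedding_halfTraj_val (G : SimpleGraph V) :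
    MeasurableEmbedding fun w : HalfTraj G => w.1 :=
  MeasurableEmbedding.subtype_coe (measurableSet_isTraj G)

theorem measurableSet_traj_eval_mem (n : ℤ) (A : Set V) :
    MeasurableSet {w : Traj G | w.1 n ∈ A} :=
  (measurableEmbedding_traj_val G).measurable (measurableSet_eval_mem n A)

theorem measurableSet_hits (K : Finset V) : MeasurableSet {w : Traj G | w.Hits K} :=
  (measurableEmbedding_traj_val G).measurable (measurableSet_exists_mem (K : Set V))

theorem measurableSet_hitSet (K : Finset V) : MeasurableSet (hitSet G K) := by
  rw [measurableSet_quotient]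
  convert measurableSet_hits (G := G) K using 1
  ext w
  exact mk_mem_hitSet

theorem measurable_lam (K : Finset V) : Measurable (Traj.lam (G := G) K) := by
  refine measurable_to_countable' fun k => ?_
  have lam_preimage : Traj.lam K ⁻¹' {k}
      = ({w : Traj G | w.1 k ∈ (K : Set V)} ∩ ⋂ n > k, {w | w.1 n ∈ (K : Set V)}ᶜ)
        ∪ ({w | w.Hits K}ᶜ ∩ {_w | k = 0}) := by
    ext w
    simp only [Set.mem_preimage, Set.mem_singleton_iff, Set.mem_union, Set.mem_inter_iff,
      Set.mem_iInter, Set.mem_compl_iff, Set.mem_ofPred_eq, SetLike.mem_coe]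
    by_cases hw : w.Hits K
    · rw [lam_eq_iff hw]
      tauto
    · rw [lam_of_not_hits hw]
      have not_mem : w.1 k ∉ K := fun hk => hw ⟨k, hk⟩
      tauto
  rw [lam_preimage]
  exact ((measurableSet_traj_eval_mem _ _).inter (MeasurableSet.iInter fun n =>
    MeasurableSet.iInter fun _ => (measurableSet_traj_eval_mem _ _).compl)).union
      ((measurableSet_hits K).compl.inter (MeasurableSet.const _))

theorem measurable_eval_at {t : Traj G → ℤ} (ht : Measurable t) :
    Measurable fun w : Traj G => w.1 (t w) :=
  (measurable_from_prod_countable_left (f := fun p : Traj G × ℤ => p.1.1 p.2) fun n =>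
    (measurable_pi_apply n).comp (measurableEmbedding_traj_val G).measurable).comp
      (measurable_id.prodMk ht)

theorem measurable_future (K : Finset V) : Measurable (Traj.future (G := G) K) :=
  (measurableEmbedding_halfTraj_val G).measurable_comp_iff.1
    (measurable_pi_lambda _ fun n => measurable_eval_at ((measurable_lam K).add_const (n : ℤ)))

theorem measurable_keepFuture (K : Finset V) : Measurable (keepFuture (G := G) K) := by
  classical
  exact measurable_from_quotient.2 <| Measurable.ite (measurableSet_hits K)
    (measurable_inl.comp (measurable_future K)) (measurable_inr.comp measurable_mk)

end Trajectories

/-! ### Time reversal and anchoring -/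

section Reversal

variable {V : Type*} {G : SimpleGraph V}

/-- The time reversal of a two-sided sequence. -/
def reflect (w : ℤ → V) (n : ℤ) : V := w (-n)

theorem reflect_reflect (w : ℤ → V) : reflect (reflect w) = w := by
  funext n
  simp [reflect]

theorem reflect_shift (k : ℤ) (w : ℤ → V) : reflect (shift k w) = shift (-k) (reflect w) := by
  funext n
  simp only [reflect, shift]
  ring_nf

theorem reflect_glue {u v : ℕ → V} (huv : u 0 = v 0) : reflect (glue (u, v)) = glue (v, u) := by
  funext n
  obtain ⟨k, rfl | rfl⟩ := n.eq_nat_or_neg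
  · rw [reflect, glue_neg_natCast huv, glue_natCast]
  · rw [reflect, neg_neg, glue_neg_natCast huv.symm, glue_natCast]

/-- The time reversal of a trajectory. -/
def Traj.reverse (w : Traj G) : Traj G :=
  ⟨reflect w.1, fun n => by
      have adj := (w.2.1 (-(n + 1))).symm
      rwa [neg_add, neg_add_cancel_right, ← neg_add] at adj,
    fun x => (w.2.2 x).preimage neg_injective.injOn⟩

theorem Traj.hits_reverse {K : Finset V} {w : Traj G} : w.reverse.Hits K ↔ w.Hits K :=
  (Equiv.neg ℤ).exists_congr fun _ => Iff.rfl

theorem Traj.tau_eq_neg_lam_reverse (K : Finset V) (w : Traj G) :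
    w.tau K = -w.reverse.lam K := by
  by_cases hw : w.Hits K
  · obtain ⟨reverse_lam_mem, reverse_notMem⟩ := (lam_eq_iff (hits_reverse.2 hw) _).1 rfl
    refine IsLeast.csInf_eq ⟨reverse_lam_mem, fun n hn => ?_⟩
    by_contra hlt
    exact reverse_notMem (-n) (by omega) (by simpa [reverse, reflect] using hn)
  · have visits_eq_empty : {n | w.1 n ∈ K} = ∅ :=
      Set.eq_empty_of_forall_notMem fun n hn => hw ⟨n, hn⟩
    rw [tau, visits_eq_empty, Int.csInf_empty, lam_of_not_hits (hits_reverse.not.2 hw), neg_zero]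

theorem Traj.past_eq_future_reverse (K : Finset V) (w : Traj G) :
    w.past K = w.reverse.future K := by
  refine Subtype.ext (funext fun n => ?_)
  change w.1 (w.tau K - n) = w.1 (-(w.reverse.lam K + n))
  rw [tau_eq_neg_lam_reverse, neg_add']

/-- The time reversal of a trajectory modulo shift. -/
def TrajMod.reverse : TrajMod G → TrajMod G :=
  Quotient.map Traj.reverse fun w w' ⟨k, h⟩ => ⟨-k, fun n => by
    change w.1 (-(n + -k)) = w'.1 (-n)
    rw [neg_add, neg_neg, h]⟩

theorem TrajMod.reverse_reverse (z : TrajMod G) : z.reverse.reverse = z := by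
  induction z using Quotient.inductionOn with
  | h w => exact congrArg _ (Subtype.ext (reflect_reflect w.1))

theorem TrajMod.preimage_reverse_hitSet (K : Finset V) :
    TrajMod.reverse ⁻¹' hitSet G K = hitSet G K := by
  ext z
  induction z using Quotient.inductionOn with
  | h w => exact mk_mem_hitSet.trans (Traj.hits_reverse.trans mk_mem_hitSet.symm)

theorem keepPast_eq (K : Finset V) :
    keepPast (G := G) K = Sum.map id TrajMod.reverse ∘ keepFuture K ∘ TrajMod.reverse := by
  funext z
  induction z using Quotient.inductionOn with
  | h w =>
    change _ = Sum.map id TrajMod.reverse (keepFuture K ⟦w.reverse⟧)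
    by_cases hw : w.Hits K
    · rw [keepFuture_of_hits (Traj.hits_reverse.2 hw), Sum.map_inl, id,
        ← Traj.past_eq_future_reverse]
      exact if_pos hw
    · rw [keepFuture_of_not_hits (Traj.hits_reverse.not.2 hw), Sum.map_inr]
      exact (if_neg hw).trans (congrArg Sum.inr (TrajMod.reverse_reverse ⟦w⟧).symm)

variable [MeasurableSpace V]

theorem measurable_reflect : Measurable (reflect (V := V)) :=
  measurable_pi_lambda _ fun _ => measurable_pi_apply _

theorem measurable_trajMod_reverse : Measurable (TrajMod.reverse (G := G)) :=
  measurable_from_quotient.2 <| measurable_mk.comp <|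
    (measurable_reflect.comp measurable_subtype_coe).subtype_mk

end Reversal

section Anchors

variable {V : Type*}

/-- Two-sided sequences that leave `K` at time `0`. -/
def leavesAtZero (K : Finset V) : Set (ℤ → V) := {w | w 0 ∈ K ∧ ∀ n > 0, w n ∉ K}

/-- Two-sided sequences that enter `K` at time `0`. -/
def entersAtZero (K : Finset V) : Set (ℤ → V) := reflect ⁻¹' leavesAtZero K

theorem glue_mem_leavesAtZero {K : Finset V} {u v : ℕ → V} :
    glue (u, v) ∈ leavesAtZero K ↔ v 0 ∈ K ∧ returnTime (K : Set V) v = ⊤ := by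
  rw [leavesAtZero, Set.mem_ofPred_eq, glue_zero, returnTime_eq_top_iff]
  refine and_congr_right fun _ => ⟨fun h n hn => ?_, fun h n hn => ?_⟩
  · rw [← glue_natCast (u := u) (v := v)]
    exact h n (by omega)
  · obtain ⟨k, rfl⟩ := Int.eq_ofNat_of_zero_le hn.le
    rw [glue_natCast]
    exact h k (by omega)

theorem glue_mem_entersAtZero {K : Finset V} {u v : ℕ → V} (huv : u 0 = v 0) :
    glue (u, v) ∈ entersAtZero K ↔ u 0 ∈ K ∧ returnTime (K : Set V) u = ⊤ := by
  rw [entersAtZero, Set.mem_preimage, reflect_glue huv, glue_mem_leavesAtZero]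

variable {G : SimpleGraph V}

theorem existsUnique_leavesAtZero {K : Finset V} {w : Traj G} (h : w.Hits K) :
    ∃! k, shift k w.1 ∈ leavesAtZero K := by
  have shift_mem_iff : ∀ k, shift k w.1 ∈ leavesAtZero K ↔ w.lam K = k := by
    intro k
    rw [lam_eq_iff h]
    simp only [leavesAtZero, shift, Set.mem_ofPred_eq, zero_add]
    refine and_congr_right fun _ => ⟨fun hn n hnk => ?_, fun hn n hn0 => hn _ (by omega)⟩
    simpa using hn (n - k) (by omega)
  simp only [shift_mem_iff, existsUnique_eq']

theorem existsUnique_entersAtZero {K : Finset V} {w : Traj G} (h : w.Hits K) :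
    ∃! k, shift k w.1 ∈ entersAtZero K := by
  refine ((Equiv.neg ℤ).existsUnique_congr fun {k} => ?_).2
    (existsUnique_leavesAtZero (Traj.hits_reverse.2 h))
  rw [entersAtZero, Set.mem_preimage, reflect_shift]
  rfl

/-- The two-sided sequences whose class modulo shift lies in `D`. -/
def unfold (D : Set (TrajMod G)) : Set (ℤ → V) :=
  (fun w : Traj G => w.1) '' (Quotient.mk (shiftSetoid G) ⁻¹' D)

theorem val_mem_unfold {D : Set (TrajMod G)} {w : Traj G} : w.1 ∈ unfold D ↔ ⟦w⟧ ∈ D :=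
  Subtype.val_injective.mem_set_image

theorem unfold_iUnion {ι : Sort*} (D : ι → Set (TrajMod G)) :
    unfold (⋃ i, D i) = ⋃ i, unfold (D i) := by
  simp only [unfold, Set.preimage_iUnion, Set.image_iUnion]

theorem disjoint_unfold {D D' : Set (TrajMod G)} (h : Disjoint D D') :
    Disjoint (unfold D) (unfold D') :=
  (Set.disjoint_image_iff Subtype.val_injective).2 (h.preimage _)

theorem shift_mem_unfold {D : Set (TrajMod G)} {w : ℤ → V} (k : ℤ) (h : w ∈ unfold D) :
    shift k w ∈ unfold D := by
  obtain ⟨t, ht, rfl⟩ := h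
  have adj : ∀ n, G.Adj (shift k t.1 n) (shift k t.1 (n + 1)) := fun n => by
    simpa only [shift, add_right_comm] using t.2.1 (n + k)
  have finite_visits : ∀ x, {n | shift k t.1 n = x}.Finite := fun x =>
    (t.2.2 x).preimage (add_left_injective k).injOn
  let t' : Traj G := ⟨shift k t.1, adj, finite_visits⟩
  have mk_eq : (⟦t⟧ : TrajMod G) = ⟦t'⟧ := Quotient.sound ⟨k, fun _ => rfl⟩
  exact ⟨t', (congrArg (· ∈ D) mk_eq).mp ht, rfl⟩

theorem preimage_shift_unfold (D : Set (TrajMod G)) (k : ℤ) : shift k ⁻¹' unfold D = unfold D := by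
  ext w
  refine ⟨fun h => ?_, fun h => shift_mem_unfold k h⟩
  simpa only [shift_shift, neg_add_cancel, shift_zero] using shift_mem_unfold (-k) h

theorem preimage_reflect_unfold (D : Set (TrajMod G)) :
    reflect ⁻¹' unfold D = unfold (TrajMod.reverse ⁻¹' D) := by
  ext w
  constructor
  · rintro ⟨t, ht, hw⟩
    refine ⟨t.reverse, ?_, (congrArg reflect hw).trans (reflect_reflect w)⟩
    change TrajMod.reverse (TrajMod.reverse ⟦t⟧) ∈ D
    rwa [TrajMod.reverse_reverse]
  · rintro ⟨t, ht, rfl⟩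
    exact ⟨t.reverse, ht, rfl⟩

variable [MeasurableSpace V] [DiscreteMeasurableSpace V]

theorem measurableSet_leavesAtZero (K : Finset V) : MeasurableSet (leavesAtZero K) := by
  simp only [leavesAtZero, Set.ofPred_and, Set.ofPred_forall]
  exact (measurableSet_eval_mem 0 (K : Set V)).inter (MeasurableSet.iInter fun n =>
    MeasurableSet.iInter fun _ => (measurableSet_eval_mem n (K : Set V)).compl)

theorem measurableSet_entersAtZero (K : Finset V) : MeasurableSet (entersAtZero K) :=
  measurable_reflect (measurableSet_leavesAtZero K)

theorem measurableSet_unfold [Countable V] {D : Set (TrajMod G)} (hD : MeasurableSet D) :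
    MeasurableSet (unfold D) :=
  (measurableEmbedding_traj_val G).measurableSet_image.2 (measurable_mk hD)

end Anchors

/-! ### The intensity measure -/

namespace Network

variable {V : Type*} {N : Network V} [MeasurableSpace V] [DiscreteMeasurableSpace V]

theorem twoSided_eq_tsum_inter {A F : Set (ℤ → V)} (hA : MeasurableSet A)
    (hF : MeasurableSet F) (h : ∀ w ∈ A, ∃! k, shift k w ∈ F) :
    N.twoSided A = ∑' k, N.twoSided (A ∩ shift k ⁻¹' F) := by
  rw [← measure_iUnion, ← Set.inter_iUnion, Set.inter_eq_left.2]
  · exact fun w hw => Set.mem_iUnion.2 (h w hw).exists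
  · exact fun i j hij => Set.disjoint_left.2 fun w hi hj => hij ((h w hi.1).unique hi.2 hj.2)
  · exact fun k => hA.inter (measurable_shift k hF)

theorem eqMass_smul_cond {K : Finset V} {x : V} (hx : x ∈ K) :
    N.eqMass K x • (N.P x)[|{w | returnTime (K : Set V) w = ⊤}]
      = N.mass x • (N.P x).restrict {w | returnTime (K : Set V) w = ⊤} := by
  rw [eqMass, if_pos hx, ← mass, mul_smul, ProbabilityTheory.cond, smul_smul (N.P x _)]
  by_cases never_escapes : N.P x {w | returnTime (K : Set V) w = ⊤} = 0
  · rw [Measure.restrict_eq_zero.2 never_escapes, smul_zero]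
  · rw [ENNReal.mul_inv_cancel never_escapes (measure_ne_top _ _), one_smul]

variable [Countable V]

variable (N) in
theorem map_reflect_twoSided : N.twoSided.map reflect = N.twoSided := by
  rw [twoSided, Measure.map_sum measurable_reflect.aemeasurable]
  congr 1 with x : 1
  rw [Measure.map_smul, Measure.map_map measurable_reflect measurable_glue]
  conv_rhs => rw [← Measure.prod_swap, Measure.map_map measurable_glue measurable_swap]
  exact congrArg _ (Measure.map_congr ((ae_prod_start x).mono fun q hq =>
    reflect_glue (hq.1.trans hq.2.symm)))

-- Mass transport: `F` and `F'` are two equivariant choices of the origin of time, and `w ∈ A ∩ F`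
-- sends its mass to the origin chosen by `F'`.
theorem twoSided_inter_eq_of_existsUnique_shift {A F F' : Set (ℤ → V)} (hA : MeasurableSet A)
    (hA_shift : ∀ k, shift k ⁻¹' A = A) (hF : MeasurableSet F) (hF' : MeasurableSet F')
    (h : ∀ w ∈ A, ∃! k, shift k w ∈ F) (h' : ∀ w ∈ A, ∃! k, shift k w ∈ F') :
    N.twoSided (A ∩ F) = N.twoSided (A ∩ F') := by
  rw [twoSided_eq_tsum_inter (hA.inter hF) hF' fun w hw => h' w hw.1,
    twoSided_eq_tsum_inter (hA.inter hF') hF fun w hw => h w hw.1, ← (Equiv.neg ℤ).tsum_eq]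
  refine tsum_congr fun k => ?_
  have measurableSet_inter : MeasurableSet (A ∩ F ∩ shift (-k) ⁻¹' F') :=
    (hA.inter hF).inter (measurable_shift _ hF')
  have shift_comp_shift : shift (V := V) (-k) ∘ shift k = id := by
    funext w
    rw [Function.comp_apply, shift_shift, neg_add_cancel, shift_zero, id]
  rw [Equiv.neg_apply,
    ← (N.measurePreserving_shift k).measure_preimage measurableSet_inter.nullMeasurableSet,
    Set.preimage_inter, Set.preimage_inter, hA_shift, ← Set.preimage_comp, shift_comp_shift,
    Set.preimage_id, Set.inter_right_comm]

theorem nuK_apply (K : Finset V) {S : Set (Traj N.graph)} (hS : MeasurableSet S) :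
    N.nuK K S = N.twoSided ((fun w : Traj N.graph => w.1) '' S ∩ entersAtZero K) := by
  have hA : MeasurableSet ((fun w : Traj N.graph => w.1) '' S) :=
    (measurableEmbedding_traj_val N.graph).measurableSet_image.2 hS
  rw [twoSided_apply_of_ae_iff (hA.inter (measurableSet_entersAtZero K)) (K := K)
    (R := glue ⁻¹' ((fun w : Traj N.graph => w.1) '' S) ∩
      {w | returnTime (K : Set V) w = ⊤} ×ˢ Set.univ)]
  · refine ((measurableEmbedding_traj_val N.graph).comap_apply _ _).trans ?_
    rw [Measure.coe_finsetSum, Finset.sum_apply]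
    refine Finset.sum_congr rfl fun x hx => ?_
    rw [← Measure.map_smul, ← Measure.prod_smul_left, eqMass_smul_cond hx,
      Measure.prod_smul_left, Measure.map_smul, Measure.smul_apply, smul_eq_mul,
      Measure.map_apply measurable_glue hA, ← Measure.restrict_apply (measurable_glue hA),
      ← Measure.prod_restrict, Measure.restrict_univ]
  · intro y
    filter_upwards [ae_prod_start y] with q hq
    rw [Set.mem_inter_iff, glue_mem_entersAtZero (hq.1.trans hq.2.symm), hq.1, Set.mem_inter_iff,
      Set.mem_prod, and_iff_left (Set.mem_univ q.2)]
    exact and_left_comm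

theorem nu_apply_eq_tsum (K : ℕ → Finset V) {D : Set (TrajMod N.graph)} (hD : MeasurableSet D) :
    N.nu K D = ∑' n, N.twoSided
      (unfold (D ∩ (hitSet N.graph (K (n + 1)) \ hitSet N.graph (K n)))
        ∩ entersAtZero (K (n + 1))) := by
  rw [nu, Measure.map_apply measurable_mk hD, Measure.sum_apply _ (measurable_mk hD)]
  refine tsum_congr fun n => ?_
  have preimage_new_hits : {w : Traj N.graph | w.Hits (K (n + 1)) ∧ ¬ w.Hits (K n)}
      = Quotient.mk _ ⁻¹' (hitSet N.graph (K (n + 1)) \ hitSet N.graph (K n)) := by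
    ext w
    exact and_congr mk_mem_hitSet.symm mk_mem_hitSet.not.symm
  rw [Measure.restrict_apply (measurable_mk hD), preimage_new_hits, ← Set.preimage_inter, nuK_apply]
  · rfl
  · exact measurable_mk
      (hD.inter ((measurableSet_hitSet _).diff (measurableSet_hitSet _)))

theorem nu_apply_of_existsUnique_shift {K : ℕ → Finset V} (hK : IsExhaustion K) (hK0 : K 0 = ∅)
    {D : Set (TrajMod N.graph)} (hD : MeasurableSet D) {F : Set (ℤ → V)} (hF : MeasurableSet F)
    (h : ∀ w ∈ unfold D, ∃! k, shift k w ∈ F) :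
    N.nu K D = N.twoSided (unfold D ∩ F) := by
  let newHits n := hitSet N.graph (K (n + 1)) \ hitSet N.graph (K n)
  have measurableSet_inter_newHits n : MeasurableSet (D ∩ newHits n) :=
    hD.inter ((measurableSet_hitSet _).diff (measurableSet_hitSet _))
  have iUnion_unfold_inter : ⋃ n, unfold (D ∩ newHits n) ∩ F = unfold D ∩ F := by
    rw [← Set.iUnion_inter, ← unfold_iUnion, ← Set.inter_iUnion, iUnion_hitSet_diff hK hK0,
      Set.inter_univ]
  rw [nu_apply_eq_tsum K hD, ← iUnion_unfold_inter, measure_iUnion]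
  · refine tsum_congr fun n => twoSided_inter_eq_of_existsUnique_shift
      (measurableSet_unfold (measurableSet_inter_newHits n)) (preimage_shift_unfold _)
      (measurableSet_entersAtZero _) hF ?_ ?_
    · rintro _ ⟨w, hw, rfl⟩
      exact existsUnique_entersAtZero (mk_mem_hitSet.1 hw.2.1)
    · rintro _ ⟨w, hw, rfl⟩
      exact h _ ⟨w, hw.1, rfl⟩
  · exact fun m n hmn => (disjoint_unfold ((pairwise_disjoint_hitSet_diff hK hmn).mono
      Set.inter_subset_right Set.inter_subset_right)).mono Set.inter_subset_left
        Set.inter_subset_left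
  · exact fun n => (measurableSet_unfold (measurableSet_inter_newHits n)).inter hF

theorem nu_apply_entersAtZero {K : ℕ → Finset V} (hK : IsExhaustion K) (hK0 : K 0 = ∅)
    {B : Finset V} {D : Set (TrajMod N.graph)} (hD : MeasurableSet D)
    (hDB : D ⊆ hitSet N.graph B) :
    N.nu K D = N.twoSided (unfold D ∩ entersAtZero B) := by
  refine nu_apply_of_existsUnique_shift hK hK0 hD (measurableSet_entersAtZero B) ?_
  rintro _ ⟨w, hw, rfl⟩
  exact existsUnique_entersAtZero (mk_mem_hitSet.1 (hDB hw))

theorem nu_apply_leavesAtZero {K : ℕ → Finset V} (hK : IsExhaustion K) (hK0 : K 0 = ∅)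
    {B : Finset V} {D : Set (TrajMod N.graph)} (hD : MeasurableSet D)
    (hDB : D ⊆ hitSet N.graph B) :
    N.nu K D = N.twoSided (unfold D ∩ leavesAtZero B) := by
  refine nu_apply_of_existsUnique_shift hK hK0 hD (measurableSet_leavesAtZero B) ?_
  rintro _ ⟨w, hw, rfl⟩
  exact existsUnique_leavesAtZero (mk_mem_hitSet.1 (hDB hw))

theorem map_reverse_nu {K : ℕ → Finset V} (hK : IsExhaustion K) (hK0 : K 0 = ∅) :
    (N.nu K).map TrajMod.reverse = N.nu K := by
  refine (Measure.ext_iff_of_iUnion_eq_univ (iUnion_hitSet hK)).2 fun n => ?_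
  refine Measure.ext fun D hD => ?_
  have hD' := hD.inter (measurableSet_hitSet (G := N.graph) (K n))
  have reverse_subset : TrajMod.reverse ⁻¹' (D ∩ hitSet N.graph (K n)) ⊆ hitSet N.graph (K n) :=
    (Set.preimage_mono Set.inter_subset_right).trans
      (TrajMod.preimage_reverse_hitSet (G := N.graph) (K n)).subset
  rw [Measure.restrict_apply hD, Measure.restrict_apply hD,
    Measure.map_apply measurable_trajMod_reverse hD',
    nu_apply_entersAtZero hK hK0 (measurable_trajMod_reverse hD') reverse_subset,
    nu_apply_leavesAtZero hK hK0 hD' Set.inter_subset_right, ← preimage_reflect_unfold,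
    entersAtZero, ← Set.preimage_inter, ← Measure.map_apply measurable_reflect
      ((measurableSet_unfold hD').inter (measurableSet_leavesAtZero _)), map_reflect_twoSided]

end Network

/-! ### Cuts and the zero-one laws -/

section Kept

variable {V : Type*} {G : SimpleGraph V}

/-- The function `f` of the starting vertex of a half-trajectory, extended by `0` to the
trajectories that a cut keeps whole. -/
def startFun (f : V → ℝ≥0∞) : HalfTraj G ⊕ TrajMod G → ℝ≥0∞ :=
  Sum.elim (fun w => f (w.1 0)) fun _ => 0

theorem startFun_le_one {f : V → ℝ≥0∞} (hf : ∀ y, f y ≤ 1) : startFun (G := G) f ≤ 1 := by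
  rintro (w | z)
  · exact hf _
  · exact zero_le

theorem startFun_sq (f : V → ℝ≥0∞) (t : HalfTraj G ⊕ TrajMod G) :
    startFun f t ^ 2 = startFun (fun y => f y ^ 2) t := by
  cases t <;> simp [startFun]

theorem indicator_range_inl_startFun (f : V → ℝ≥0∞) :
    (Set.range Sum.inl).indicator (startFun (G := G) f) = startFun f := by
  refine Set.indicator_eq_self.2 fun t ht => ?_
  cases t with
  | inl w => exact ⟨w, rfl⟩
  | inr z => exact absurd rfl ht

theorem exists_glue_mem_iff {K B : Finset V} (hB : B ⊆ K) {u v : ℕ → V} (huv : u 0 = v 0)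
    (hv : returnTime (K : Set V) v = ⊤) : (∃ n, glue (u, v) n ∈ B) ↔ ∃ n, u n ∈ B := by
  constructor
  · rintro ⟨n, hn⟩
    obtain ⟨k, rfl | rfl⟩ := n.eq_nat_or_neg
    · rw [glue_natCast] at hn
      have k_eq_zero : k = 0 := by
        by_contra hk
        exact returnTime_eq_top_iff.1 hv k (Nat.one_le_iff_ne_zero.2 hk) (hB hn)
      exact ⟨0, by rwa [huv, ← k_eq_zero]⟩
    · exact ⟨k, by rwa [glue_neg_natCast huv] at hn⟩
  · rintro ⟨n, hn⟩
    exact ⟨-n, by rwa [glue_neg_natCast huv]⟩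

theorem keepFuture_mk_of_leavesAtZero {K : Finset V} {w : Traj G} {v : HalfTraj G}
    (h : w.1 ∈ leavesAtZero K) (hv : ∀ n : ℕ, w.1 n = v.1 n) : keepFuture K ⟦w⟧ = Sum.inl v := by
  have hits : w.Hits K := ⟨0, h.1⟩
  have lam_eq_zero : w.lam K = 0 := (lam_eq_iff hits 0).2 h
  rw [keepFuture_of_hits hits]
  refine congrArg Sum.inl (Subtype.ext (funext fun n => ?_))
  change w.1 (w.lam K + n) = v.1 n
  rw [lam_eq_zero, zero_add, hv]

theorem glue_mem_unfold_keepFuture_iff {K B : Finset V} (hB : B ⊆ K) {u v : HalfTraj G}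
    (huv : u.1 0 = v.1 0) (T : Set (HalfTraj G ⊕ TrajMod G)) :
    glue (u.1, v.1) ∈ unfold (keepFuture K ⁻¹' T ∩ hitSet G B) ∩ leavesAtZero K ↔
      u.1 0 ∈ K ∧ (∃ n, u.1 n ∈ B) ∧ Sum.inl v ∈ T ∧ returnTime (K : Set V) v.1 = ⊤ := by
  let w : Traj G := ⟨glue (u.1, v.1), isTraj_glue huv u.2 v.2⟩
  rw [Set.mem_inter_iff, show glue (u.1, v.1) = w.1 from rfl, val_mem_unfold, Set.mem_inter_iff,
    Set.mem_preimage, mk_mem_hitSet, huv]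
  have leaves_iff : w.1 ∈ leavesAtZero K ↔ v.1 0 ∈ K ∧ returnTime (K : Set V) v.1 = ⊤ :=
    glue_mem_leavesAtZero
  have hits_iff : returnTime (K : Set V) v.1 = ⊤ → (w.Hits B ↔ ∃ n, u.1 n ∈ B) :=
    exists_glue_mem_iff hB huv
  have keepFuture_eq : w.1 ∈ leavesAtZero K → keepFuture K ⟦w⟧ = Sum.inl v := fun h =>
    keepFuture_mk_of_leavesAtZero h fun n => glue_natCast (u := u.1) n
  constructor
  · rintro ⟨⟨mem_T, hits⟩, leaves⟩
    obtain ⟨start_mem, no_return⟩ := leaves_iff.1 leaves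
    exact ⟨start_mem, (hits_iff no_return).1 hits, keepFuture_eq leaves ▸ mem_T, no_return⟩
  · rintro ⟨start_mem, hits, mem_T, no_return⟩
    have leaves := leaves_iff.2 ⟨start_mem, no_return⟩
    exact ⟨⟨(keepFuture_eq leaves).symm ▸ mem_T, (hits_iff no_return).2 hits⟩, leaves⟩

variable [MeasurableSpace V]

theorem measurable_config_val : Measurable fun ω : Config G => ω.1 :=
  Measure.measurable_of_measurable_coe _ fun D hD =>
    Measurable.of_comap_le (le_iSup₂_of_le D hD le_rfl)

theorem IsPoissonProcess.isPoissonRandomMeasure {ν : Measure (TrajMod G)}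
    {Pr : Measure (Config G)} (h : IsPoissonProcess ν Pr) :
    IsPoissonRandomMeasure ν (fun ω : Config G => ω.1) Pr :=
  ⟨measurable_config_val, h.poisson, h.indep⟩

variable [DiscreteMeasurableSpace V]

theorem measurable_startFun (f : V → ℝ≥0∞) : Measurable (startFun (G := G) f) :=
  (Measurable.of_discrete.comp ((measurable_pi_apply 0).comp measurable_subtype_coe)).sumElim
    measurable_const

end Kept

namespace Network

variable {V : Type*} {N : Network V} [MeasurableSpace V] [DiscreteMeasurableSpace V]

variable (N) in
/-- The law of the chain from `y` on the event that it does not return to `K`, on the space of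
half-trajectories. -/
def escapeLaw (K : Finset V) (y : V) : Measure (HalfTraj N.graph) :=
  ((N.P y).restrict {w | returnTime (K : Set V) w = ⊤}).comap fun w => w.1

variable (N) in
/-- The law of the pieces kept by a cut at `K`: they start at `y ∈ K` with weight `a_y f y` and
never return to `K`. -/
def keptLaw (K : Finset V) (f : V → ℝ≥0∞) : Measure (HalfTraj N.graph ⊕ TrajMod N.graph) :=
  ∑ y ∈ K, (N.mass y * f y) • (N.escapeLaw K y).map Sum.inl

theorem lintegral_keptLaw (K : Finset V) (f : V → ℝ≥0∞)
    {g : HalfTraj N.graph ⊕ TrajMod N.graph → ℝ≥0∞} (hg : Measurable g) :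
    ∫⁻ t, g t ∂N.keptLaw K f = ∑ y ∈ K, N.mass y * f y * ∫⁻ w, g (Sum.inl w) ∂N.escapeLaw K y := by
  rw [keptLaw, lintegral_finsetSum_measure]
  refine Finset.sum_congr rfl fun y _ => ?_
  rw [lintegral_smul_measure, smul_eq_mul, lintegral_map hg measurable_inl]

theorem map_sumMap_keptLaw (K : Finset V) (f : V → ℝ≥0∞) {r : TrajMod N.graph → TrajMod N.graph}
    (hr : Measurable r) : (N.keptLaw K f).map (Sum.map id r) = N.keptLaw K f := by
  refine Measure.ext_of_lintegral _ fun g hg => ?_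
  have hr' : Measurable (Sum.map id r : HalfTraj N.graph ⊕ TrajMod N.graph → _) :=
    measurable_id.sumMap hr
  rw [lintegral_map hg hr', lintegral_keptLaw _ _ hg]
  exact lintegral_keptLaw _ _ (hg.comp hr')

variable [Countable V]

theorem escapeLaw_apply (K : Finset V) (y : V) {T : Set (HalfTraj N.graph)}
    (hT : MeasurableSet T) :
    N.escapeLaw K y T =
      N.P y ((fun w : HalfTraj N.graph => w.1) '' T ∩ {w | returnTime (K : Set V) w = ⊤}) :=
  ((measurableEmbedding_halfTraj_val N.graph).comap_apply _ _).trans <|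
    Measure.restrict_apply ((measurableEmbedding_halfTraj_val N.graph).measurableSet_image.2 hT)

theorem hitProb_of_mem {B : Set V} {y : V} (hy : y ∈ B) : N.hitProb B y = 1 :=
  (mem_ae_iff_prob_eq_one₀ (measurableSet_exists_mem B).nullMeasurableSet).1
    ((N.P_zero_ae y).mono fun _ start => ⟨0, start.symm ▸ hy⟩)

instance isFiniteMeasure_eqMeasure (K : Finset V) : IsFiniteMeasure (N.eqMeasure K) :=
  ⟨by
    rw [← lintegral_one, lintegral_eqMeasure]
    refine ENNReal.sum_lt_top.2 fun x hx => ?_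
    rw [mul_one, eqMass, if_pos hx]
    exact ENNReal.mul_lt_top ENNReal.ofReal_lt_top (measure_lt_top _ _)⟩

theorem mass_mul_escapeLaw_univ_le {K : Finset V} {y : V} (hy : y ∈ K) :
    N.mass y * N.escapeLaw K y Set.univ ≤ N.eqMass K y := by
  rw [eqMass, if_pos hy, escapeLaw_apply K y MeasurableSet.univ]
  exact mul_le_mul_right (measure_mono Set.inter_subset_right) _

theorem escapeLaw_ae_start (K : Finset V) (y : V) : ∀ᵐ w ∂N.escapeLaw K y, w.1 0 = y := by
  refine ((measurableEmbedding_halfTraj_val N.graph).ae_map_iff (p := fun w => w 0 = y)).1 ?_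
  rw [escapeLaw, (measurableEmbedding_halfTraj_val N.graph).map_comap]
  exact ae_restrict_of_ae (ae_restrict_of_ae (N.P_zero_ae y))

theorem lintegral_keptLaw_startFun_mul (K : Finset V) (f : V → ℝ≥0∞)
    {g : HalfTraj N.graph ⊕ TrajMod N.graph → ℝ≥0∞} (hg : Measurable g) :
    ∫⁻ t, startFun f t * g t ∂N.keptLaw K 1 = ∫⁻ t, g t ∂N.keptLaw K f := by
  rw [lintegral_keptLaw _ _ ((measurable_startFun f).fun_mul hg), lintegral_keptLaw _ _ hg]
  refine Finset.sum_congr rfl fun y _ => ?_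
  have start_eq : ∫⁻ w, startFun f (Sum.inl w) * g (Sum.inl w) ∂N.escapeLaw K y
      = f y * ∫⁻ w, g (Sum.inl w) ∂N.escapeLaw K y := by
    refine Eq.trans ?_ (lintegral_const_mul _ (hg.comp measurable_inl))
    exact lintegral_congr_ae ((escapeLaw_ae_start K y).mono fun w hw => by
      rw [← hw]; rfl)
  rw [start_eq, Pi.one_apply, mul_one, mul_assoc]

theorem keptLaw_eq_withDensity (K : Finset V) (f : V → ℝ≥0∞) :
    N.keptLaw K f = (N.keptLaw K 1).withDensity (startFun f) := by
  refine Measure.ext fun T hT => ?_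
  rw [withDensity_apply _ hT, ← lintegral_indicator hT, ← lintegral_indicator_one hT,
    ← lintegral_keptLaw_startFun_mul K f (measurable_one.indicator hT)]
  refine lintegral_congr fun t => ?_
  by_cases ht : t ∈ T <;> simp [ht]

theorem keptLaw_univ_le (K : Finset V) (f : V → ℝ≥0∞) :
    N.keptLaw K f Set.univ ≤ ∫⁻ y, f y ∂N.eqMeasure K := by
  rw [← lintegral_one, lintegral_keptLaw _ _ measurable_const, lintegral_eqMeasure]
  refine Finset.sum_le_sum fun y hy => ?_
  rw [lintegral_one, mul_right_comm]
  exact mul_le_mul_left (mass_mul_escapeLaw_univ_le hy) _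

/-- A cut of trajectories at the finite set `K`: the trajectories that avoid `K` are kept whole,
and under the intensity `ν` the visit of a cut trajectory to `B ⊆ K` has, given what is kept of it,
the probability that the chain from the starting vertex of the kept piece visits `B`. -/
structure IsCut (ν : Measure (TrajMod N.graph)) (K : Finset V)
    (κ : TrajMod N.graph → HalfTraj N.graph ⊕ TrajMod N.graph) : Prop where
  measurable : Measurable κ
  preimage_range_inl : κ ⁻¹' Set.range Sum.inl = hitSet N.graph K
  map_restrict_hitSet : ∀ B ⊆ K, (ν.restrict (hitSet N.graph B)).map κ
    = N.keptLaw K (N.hitProb B)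

theorem IsTransient.ae_halfTraj (hN : N.IsTransient) (x : V) :
    ∀ᵐ w ∂N.P x, (∀ n, N.graph.Adj (w n) (w (n + 1))) ∧ ∀ y, {n | w n = y}.Finite :=
  (ae_adj hN.total_ne_zero x).and (hN.ae_finite_visits x)

theorem isCut_keepFuture (hN : N.IsTransient) {K : ℕ → Finset V} (hK : IsExhaustion K)
    (hK0 : K 0 = ∅) (L : Finset V) : IsCut (N.nu K) L (keepFuture L) where
  measurable := measurable_keepFuture L
  preimage_range_inl := preimage_keepFuture_range_inl L
  map_restrict_hitSet B hB := by
    refine Measure.ext fun T hT => ?_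
    have hD := (measurable_keepFuture L hT).inter (measurableSet_hitSet (G := N.graph) B)
    rw [Measure.map_apply (measurable_keepFuture L) hT,
      Measure.restrict_apply (measurable_keepFuture L hT), nu_apply_leavesAtZero hK hK0 hD
        (Set.inter_subset_right.trans (hitSet_mono hB)),
      twoSided_apply_of_ae_iff ((measurableSet_unfold hD).inter (measurableSet_leavesAtZero L))
        (K := L) (R := {u | ∃ n, u n ∈ (B : Set V)} ×ˢ
          ((fun w : HalfTraj N.graph => w.1) '' (Sum.inl ⁻¹' T) ∩
            {v | returnTime (L : Set V) v = ⊤})),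
      keptLaw, Measure.coe_finsetSum, Finset.sum_apply]
    · refine Finset.sum_congr rfl fun y _ => ?_
      rw [Measure.prod_prod, Measure.smul_apply, Measure.map_apply measurable_inl hT,
        escapeLaw_apply _ _ (measurable_inl hT), smul_eq_mul, mul_assoc, hitProb]
    · intro y
      filter_upwards [ae_prod_start y,
        Measure.quasiMeasurePreserving_fst.ae (hN.ae_halfTraj y),
        Measure.quasiMeasurePreserving_snd.ae (hN.ae_halfTraj y)] with ⟨u, v⟩ start hu hv
      let u' : HalfTraj N.graph := ⟨u, hu⟩
      let v' : HalfTraj N.graph := ⟨v, hv⟩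
      have v_mem_image : v ∈ (fun w : HalfTraj N.graph => w.1) '' (Sum.inl ⁻¹' T)
          ↔ Sum.inl v' ∈ T := Function.Injective.mem_set_image Subtype.val_injective (a := v')
      have mem_iff := glue_mem_unfold_keepFuture_iff hB (u := u') (v := v')
        (start.1.trans start.2.symm) T
      rw [show u'.1 0 = y from start.1] at mem_iff
      exact mem_iff.trans
        (and_congr_right' (and_congr_right' (and_congr_left' v_mem_image.symm)))

theorem isCut_keepPast (hN : N.IsTransient) {K : ℕ → Finset V} (hK : IsExhaustion K)
    (hK0 : K 0 = ∅) (L : Finset V) : IsCut (N.nu K) L (keepPast L) := by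
  have cut := isCut_keepFuture hN hK hK0 L
  have hrev : Measurable (TrajMod.reverse : TrajMod N.graph → _) := measurable_trajMod_reverse
  have hmap : Measurable (Sum.map id TrajMod.reverse : HalfTraj N.graph ⊕ TrajMod N.graph → _) :=
    measurable_id.sumMap hrev
  have preimage_inl : (Sum.map id TrajMod.reverse : HalfTraj N.graph ⊕ TrajMod N.graph → _) ⁻¹'
      Set.range Sum.inl = Set.range Sum.inl := by
    ext (w | z) <;> simp
  rw [keepPast_eq]
  refine ⟨hmap.comp (cut.measurable.comp hrev), ?_, fun B hB => ?_⟩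
  · rw [Set.preimage_comp, Set.preimage_comp, preimage_inl, cut.preimage_range_inl,
      TrajMod.preimage_reverse_hitSet]
  · have restrict_reverse : ((N.nu K).restrict (hitSet N.graph B)).map TrajMod.reverse
        = (N.nu K).restrict (hitSet N.graph B) := by
      conv_rhs => rw [← map_reverse_nu hK hK0,
        Measure.restrict_map hrev (measurableSet_hitSet B), TrajMod.preimage_reverse_hitSet]
    rw [← Measure.map_map hmap (cut.measurable.comp hrev), ← Measure.map_map cut.measurable hrev,
      restrict_reverse, cut.map_restrict_hitSet B hB, map_sumMap_keptLaw _ _ hrev]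

namespace IsCut

variable {ν : Measure (TrajMod N.graph)} {K B : Finset V}
  {κ : TrajMod N.graph → HalfTraj N.graph ⊕ TrajMod N.graph}

theorem restrict_map_range_inl (h : IsCut ν K κ) :
    (ν.map κ).restrict (Set.range Sum.inl) = N.keptLaw K 1 := by
  rw [Measure.restrict_map h.measurable measurableSet_range_inl, h.preimage_range_inl,
    h.map_restrict_hitSet K subset_rfl]
  exact Finset.sum_congr rfl fun y hy => by rw [hitProb_of_mem hy, Pi.one_apply]

theorem map_restrict_eq_withDensity (h : IsCut ν K κ) (hB : B ⊆ K) :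
    (ν.restrict (hitSet N.graph B)).map κ
      = (ν.map κ).withDensity (startFun (N.hitProb B)) := by
  rw [h.map_restrict_hitSet B hB, keptLaw_eq_withDensity, ← h.restrict_map_range_inl,
    ← withDensity_indicator measurableSet_range_inl, indicator_range_inl_startFun]

theorem hitSet_ne_top (h : IsCut ν K κ) : ν (hitSet N.graph K) ≠ ∞ := by
  have hitSet_eq : ν (hitSet N.graph K) = N.keptLaw K (N.hitProb K) Set.univ := by
    rw [← h.map_restrict_hitSet K subset_rfl, Measure.map_apply h.measurable MeasurableSet.univ,
      Set.preimage_univ, Measure.restrict_apply_univ]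
  rw [hitSet_eq]
  refine ne_top_of_le_ne_top (measure_ne_top (N.eqMeasure K) Set.univ) ?_
  exact (keptLaw_univ_le K _).trans
    ((lintegral_mono (N.hitProb_le_one K)).trans_eq lintegral_one)

theorem lintegral_startFun_sq_le (h : IsCut ν K κ) (f : V → ℝ≥0∞) :
    ∫⁻ t, startFun f t ^ 2 ∂ν.map κ ≤ ∫⁻ y, f y ^ 2 ∂N.eqMeasure K := by
  calc ∫⁻ t, startFun f t ^ 2 ∂ν.map κ
      = ∫⁻ t, startFun (fun y => f y ^ 2) t ∂N.keptLaw K 1 := by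
        rw [← h.restrict_map_range_inl, ← lintegral_indicator measurableSet_range_inl,
          indicator_range_inl_startFun]
        exact lintegral_congr (startFun_sq f)
    _ = N.keptLaw K (fun y => f y ^ 2) Set.univ := by
        rw [← lintegral_one, ← lintegral_keptLaw_startFun_mul K _ measurable_const]
        simp only [mul_one]
    _ ≤ ∫⁻ y, f y ^ 2 ∂N.eqMeasure K := keptLaw_univ_le K _

end IsCut

theorem IsTransient.zero_one_of_isCut (hN : N.IsTransient) {K : ℕ → Finset V}
    (hK : IsExhaustion K) {ν : Measure (TrajMod N.graph)} {Pr : Measure (Config N.graph)}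
    (hPr : IsPoissonProcess ν Pr)
    {κ : Finset V → TrajMod N.graph → HalfTraj N.graph ⊕ TrajMod N.graph}
    (hκ : ∀ L, IsCut ν L (κ L)) {E : Set (Config N.graph)}
    (hE : MeasurableSet[⨅ L, .comap (fun ω : Config N.graph => ω.1.map (κ L)) inferInstance] E) :
    Pr E = 0 ∨ Pr E = 1 := by
  have := hPr.isProbabilityMeasure
  refine hPr.isPoissonRandomMeasure.zero_one (H := fun m => hitSet N.graph (K m))
    (κ := fun n => κ (K n)) (q := fun m _ => startFun (N.hitProb (K m)))
    (fun m n hmn => hitSet_mono (hK.mono hmn)) (fun m => measurableSet_hitSet (K m))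
    (iUnion_hitSet hK) (fun m => (hκ (K m)).hitSet_ne_top) (fun n => (hκ (K n)).measurable)
    (fun _ _ => measurable_startFun _) (fun _ _ => startFun_le_one (N.hitProb_le_one _))
    (fun m => ?_) (fun m => ?_) fun n => (MeasurableSpace.measurableSet_iInf.1 hE) (K n)
  · filter_upwards [eventually_ge_atTop m] with n hmn
    exact (hκ (K n)).map_restrict_eq_withDensity (hK.mono hmn)
  · exact tendsto_of_tendsto_of_tendsto_of_le_of_le tendsto_const_nhds
      (hN.tendsto_lintegral_hitProb_sq (K m) hK) (fun _ => zero_le)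
      fun n => (hκ (K n)).lintegral_startFun_sq_le _

end Network

end Interlacement

end

theorem mainTheorem2 {V : Type*} [Countable V] [MeasurableSpace V] [DiscreteMeasurableSpace V]
    (N : Interlacement.Network V) (hN : N.IsTransient)
    (K : ℕ → Finset V) (hK : Interlacement.IsExhaustion K) (hK0 : K 0 = ∅)
    (Pr : Measure (Interlacement.Config N.graph))
    (hPr : Interlacement.IsPoissonProcess (N.nu K) Pr) :
    (∀ E : Set (Interlacement.Config N.graph),
      MeasurableSet[Interlacement.futureTail N.graph] E → Pr E = 0 ∨ Pr E = 1) ∧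
    (∀ E : Set (Interlacement.Config N.graph),
      MeasurableSet[Interlacement.pastTail N.graph] E → Pr E = 0 ∨ Pr E = 1) ∧
    (∀ (x : V) (ε : ℝ), 0 < ε → ∀ L : ℕ → Finset V, Interlacement.IsExhaustion L →
      Tendsto (fun n => N.eqMeasure (L n)
          {x' | ENNReal.ofReal ε < N.P x' {w | Interlacement.hitTime {x} w < ⊤}})
        atTop (𝓝 0)) := by
  refine ⟨fun E hE => ?_, fun E hE => ?_, fun x ε hε L hL => ?_⟩
  · exact hN.zero_one_of_isCut hK hPr (Interlacement.Network.isCut_keepFuture hN hK hK0) hE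
  · exact hN.zero_one_of_isCut hK hPr (Interlacement.Network.isCut_keepPast hN hK hK0) hE
  · simp only [Interlacement.hitTime_lt_top_iff]
    exact hN.tendsto_eqMeasure x (ENNReal.ofReal_pos.2 hε).ne' hL
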